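/- Let $\Omega\subset\mathbb R^m$ be a domain (nonempty, open, connected) and $T_\Omega=\{z=x+iy\in\mathbb C^m: x\in\mathbb R^m,\ y\in\Omega\}$. A function $u:\mathbb R^m\to\mathbb C$ is almost periodic if it is continuous and every sequence of its shifts $u(\cdot+h_n)$, $h_n\in\mathbb R^m$, has a subsequence converging uniformly on $\mathbb R^m$. A distribution $F$ on $T_\Omega$ is almost periodic if for every test function $\varphi$ on $T_\Omega$ the function $t\mapsto\langle F(z),\varphi(z-t)\rangle$ is almost periodic on $\mathbb R^m$; its mean value is the distribution $$\varphi\mapsto\lim_{N\to\infty}(2N)^{-m}\int_{\max_j|t_j|<N}\langle F(z),\varphi(z-t)\rangle\,dt .$$ The divisor $d=d_f$ of a holomorphic function $f\not\equiv0$ on $T_\Omega$ is represented by its current of integration $$\frac i\pi\,\partial\bar\partial\log|f|=\frac2\pi\sum_{j,k=1}^m\frac{\partial^2\log|f|}{\partial z_j\,\partial\bar z_k}\,\frac i2\,dz_j\wedge d\bar z_k ,$$ and is called almost periodic if all the coefficients of this current are almost periodic distributions. In that case $A(d)=(a_{j,k})_{j,k=1}^m$ denotes the real matrix such that the mean value of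 $\frac2\pi\,\mathrm{Im}\,\frac{\partial^2\log|f|}{\partial z_j\,\partial\bar z_k}$ is $a_{j,k}\,dy\otimes dx$. Let $g$ be an entire function on $\mathbb C$ whose zeros are exactly the points of $\mathbb Z+i\mathbb Z$, all of them simple. For $\lambda,\mu\in\mathbb R^m$, not both zero, let $d[\lambda,\mu]$ be the divisor on $T_\Omega$ of the function $z\mapsto g(\langle z,\lambda\rangle+i\langle z,\mu\rangle)$, where $\langle z,\lambda\rangle=\sum_j z_j\lambda_j$. Then the divisor $d[\lambda,\mu]$ is almost periodic, the matrix $A(d[\lambda,\mu])$ exists, and $$A(d[\lambda,\mu])=(\mu,\lambda)-(\lambda,\mu),\qquad\text{where }(\lambda,\mu)=(\lambda_j\mu_k)_{j,k=1}^m .$$ -/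

import Mathlib

open MeasureTheory Filter Topology TopologicalSpace
open scoped Distributions LineDeriv

noncomputable section

namespace TubeDivisor

/-- The tube domain `T_Ω = {z = x + i y : x ∈ ℝᵐ, y ∈ Ω}` in `ℂᵐ` with open base `Ω ⊆ ℝᵐ`. -/
def tube {m : ℕ} (Ω : Opens (Fin m → ℝ)) : Opens (Fin m → ℂ) where
  carrier := {z | (fun j => (z j).im) ∈ Ω}
  is_open' := Ω.isOpen.preimage
    (continuous_pi fun j => Complex.continuous_im.comp (continuous_apply j))

/-- The inclusion `ℝᵐ ⊆ ℂᵐ`. -/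
def realVec {m : ℕ} (t : Fin m → ℝ) : Fin m → ℂ := fun j => (t j : ℂ)

/-- The translate `z ↦ φ (z - t)`, `t ∈ ℝᵐ`, of a test function on a tube domain. -/
def translate {m : ℕ} {Ω : Opens (Fin m → ℝ)} (t : Fin m → ℝ) (φ : 𝓓(tube Ω, ℝ)) :
    𝓓(tube Ω, ℝ) where
  toFun z := φ (z - realVec t)
  contDiff' := φ.contDiff.comp (contDiff_id.sub contDiff_const)
  hasCompactSupport' := φ.hasCompactSupport.comp_homeomorph (Homeomorph.subRight (realVec t))
  tsupport_subset' := by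
    intro z hz
    have h1 : z - realVec t ∈ tsupport φ :=
      tsupport_comp_subset_preimage (⇑φ) (f := fun z => z - realVec t)
        (continuous_id.sub continuous_const) hz
    have h2 : (fun j => ((z - realVec t) j).im) ∈ Ω := φ.tsupport_subset h1
    have h3 : (fun j => ((z - realVec t) j).im) = fun j => (z j).im := by
      funext j
      simp [realVec]
    rw [h3] at h2
    exact h2

/-- Almost periodic functions on `ℝᵐ` (Bochner): `u` is continuous and every sequence of shifts of
`u` has a subsequence which converges uniformly on `ℝᵐ`. -/
def IsAlmostPeriodic {m : ℕ} (u : (Fin m → ℝ) → ℂ) : Prop :=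
  Continuous u ∧ ∀ h : ℕ → (Fin m → ℝ), ∃ s : ℕ → ℕ, StrictMono s ∧
    ∃ v : (Fin m → ℝ) → ℂ, TendstoUniformly (fun n t => u (t + h (s n))) v atTop

/-- A distribution `F` on `T_Ω` is almost periodic if for every test function `φ` the function
`t ↦ ⟨F(z), φ(z - t)⟩` is almost periodic on `ℝᵐ`. -/
def IsAlmostPeriodicDistribution {m : ℕ} {Ω : Opens (Fin m → ℝ)} (F : 𝓓'(tube Ω, ℂ)) : Prop :=
  ∀ φ : 𝓓(tube Ω, ℝ), IsAlmostPeriodic fun t => F (translate t φ)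

/-- `M` is the mean value in the variable `x` of the real distribution `F` on `T_Ω`:
`⟨M, φ⟩ = lim_{N → ∞} (2N)⁻ᵐ ∫_{max |t_j| < N} ⟨F(z), φ(z - t)⟩ dt` for every test function. -/
def HasMeanValue {m : ℕ} {Ω : Opens (Fin m → ℝ)} (F M : 𝓓'(tube Ω, ℝ)) : Prop :=
  ∀ φ : 𝓓(tube Ω, ℝ),
    Tendsto (fun N : ℝ => ((2 * N) ^ m)⁻¹ *
        ∫ t in {t : Fin m → ℝ | ∀ j, |t j| < N}, F (translate t φ))
      atTop (𝓝 (M φ))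

/-- The distribution `φ ↦ ∫ u φ dx dy` on `T_Ω` given by a locally integrable function `u`. -/
def ofFunction {m : ℕ} (Ω : Opens (Fin m → ℝ)) (u : (Fin m → ℂ) → ℝ) : 𝓓'(tube Ω, ℝ) :=
  TestFunction.integralAgainstBilinCLM (ContinuousLinearMap.mul ℝ ℝ) volume u

/-- The derivative `∂/∂z_j = (1/2) (∂/∂x_j - i ∂/∂y_j)` of a distribution. -/
def dz {m : ℕ} {Ω : Opens (Fin m → ℝ)} (j : Fin m) (F : 𝓓'(tube Ω, ℂ)) : 𝓓'(tube Ω, ℂ) :=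
  (1 / 2 : ℂ) • (∂_{(Pi.single j 1 : Fin m → ℂ)} F -
    Complex.I • ∂_{(Pi.single j Complex.I : Fin m → ℂ)} F)

/-- The derivative `∂/∂z̄_k = (1/2) (∂/∂x_k + i ∂/∂y_k)` of a distribution. -/
def dzbar {m : ℕ} {Ω : Opens (Fin m → ℝ)} (k : Fin m) (F : 𝓓'(tube Ω, ℂ)) : 𝓓'(tube Ω, ℂ) :=
  (1 / 2 : ℂ) • (∂_{(Pi.single k 1 : Fin m → ℂ)} F +
    Complex.I • ∂_{(Pi.single k Complex.I : Fin m → ℂ)} F)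

/-- The divisor of a holomorphic function `f ≢ 0` on `T_Ω`, given by its current of integration
`(i/π) ∂∂̄ log|f| = ∑ (2/π) (∂² log|f| / ∂z_j ∂z̄_k) (i/2) dz_j ∧ dz̄_k`, that is, by the matrix of
the coefficients `(2/π) ∂² log|f| / ∂z_j ∂z̄_k`, which are distributions on `T_Ω`. -/
def divisorCurrent {m : ℕ} (Ω : Opens (Fin m → ℝ)) (f : (Fin m → ℂ) → ℂ) :
    Matrix (Fin m) (Fin m) 𝓓'(tube Ω, ℂ) :=
  fun j k => (2 / Real.pi : ℂ) •
    dz j (dzbar k (Distribution.mapCLM Complex.ofRealCLM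
      (ofFunction Ω fun z => Real.log ‖f z‖)))

/-- A divisor is almost periodic if all coefficients of its current are. -/
def IsAlmostPeriodicDivisor {m : ℕ} {Ω : Opens (Fin m → ℝ)}
    (d : Matrix (Fin m) (Fin m) 𝓓'(tube Ω, ℂ)) : Prop :=
  ∀ j k, IsAlmostPeriodicDistribution (d j k)

/-- `A` is the matrix `A(d) = (a_{j,k})` of the almost periodic divisor `d`: the mean values of the
imaginary parts of the coefficients of the current of `d` are `a_{j,k} dy ⊗ dx`. -/
def HasMeanMatrix {m : ℕ} {Ω : Opens (Fin m → ℝ)}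
    (d : Matrix (Fin m) (Fin m) 𝓓'(tube Ω, ℂ)) (A : Matrix (Fin m) (Fin m) ℝ) : Prop :=
  IsAlmostPeriodicDivisor d ∧
    ∀ j k, HasMeanValue (Distribution.mapCLM Complex.imCLM (d j k)) (A j k • ofFunction Ω 1)

/-- `g` is an entire function whose zeros are exactly the points of `ℤ + iℤ`, all simple. -/
def HasSimpleLatticeZeros (g : ℂ → ℂ) : Prop :=
  Differentiable ℂ g ∧ (∀ w, g w = 0 ↔ ∃ p q : ℤ, w = p + Complex.I * q) ∧
    ∀ w, g w = 0 → deriv g w ≠ 0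

/-- `⟨z, v⟩ = ∑ z_j v_j` for `z ∈ ℂᵐ` and `v ∈ ℝᵐ`. -/
def pairing {m : ℕ} (z : Fin m → ℂ) (v : Fin m → ℝ) : ℂ := ∑ j, z j * (v j : ℂ)

/-- The divisor `d[l, u]` on `T_Ω` of the function `g(⟨z, l⟩ + i⟨z, u⟩)`. -/
def latticeDivisor {m : ℕ} (Ω : Opens (Fin m → ℝ)) (g : ℂ → ℂ) (l u : Fin m → ℝ) :
    Matrix (Fin m) (Fin m) 𝓓'(tube Ω, ℂ) :=
  divisorCurrent Ω fun z => g (pairing z l + Complex.I * pairing z u)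

end TubeDivisor

end

/-! Put `V = log|g|` and `L z = ⟨z, l⟩ + i⟨z, u⟩`. Paired with `φ(z - t)`, a coefficient of the
current is `1/(2π)` times integrals of `V ∘ L` against real second-order derivatives of the shifted
test function, and it depends on `t` only through `w = L t`. Shifting `w` by `1` or `i` changes `V`
by `Re h` with `h` entire (`HasSimpleLatticeZeros.add_period`). Since `Re h(L z)` is pluriharmonic,
these derivatives do not see it, so the pairing is a continuous doubly periodic function of `w`
(`isLatticePeriodic_pullbackPairing`). Restricted to `w = L t`, such a function is almost periodic
(`IsLatticePeriodic.isAlmostPeriodic`), and if `t ↦ L t` maps `ℝᵐ` onto `ℂ` its mean is its average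
over the unit square (`IsLatticePeriodic.tendsto_mean`).

By Fubini, averaging over the square replaces `V` by its cell average. The Legendre relation between
the two multipliers, which is the argument principle around a single zero, forces this cell average
to be `Re K(w) + π (Re w)²` with `K` entire (`HasSimpleLatticeZeros.cellIntegral_log_norm`). Only
the quadratic term survives differentiation; it contributes `2π (u_j l_k - l_j u_k) ∫ φ`, and the
factor `1/(2π)` leaves the claimed entry.

If `u_j l_k - l_j u_k = 0`, the map `t ↦ L t` need not be onto. But then `L e_j` and `L e_k` are
linearly dependent over `ℝ`, and the imaginary part vanishes for every `t`, because `V ∘ L` is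
constant along the kernel of `L` (`integral_mul_imHessian_eq_zero`). -/

namespace TubeDivisor

/-! ### Entire functions with equal simple zeros; multipliers of `g` -/

/-- An entire function without zeros is the exponential of an entire function. -/
theorem exists_exp_eq_of_forall_ne_zero {q : ℂ → ℂ} (hq : Differentiable ℂ q)
    (h0 : ∀ w, q w ≠ 0) : ∃ h : ℂ → ℂ, Differentiable ℂ h ∧ ∀ w, q w = Complex.exp (h w) := by
  have hq' : Differentiable ℂ (deriv q) := fun w =>
    ((hq.differentiableOn (s := Set.univ)).deriv isOpen_univ).differentiableAt (by simp)
  have hd : Differentiable ℂ fun w => deriv q w / q w := hq'.div hq h0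
  obtain ⟨h, h00, hh⟩ := hd.isExactOn_univ.with_val_at 0 (Complex.log (q 0))
  have hh' : ∀ w, HasDerivAt h (deriv q w / q w) w := fun w => hh w (Set.mem_univ _)
  refine ⟨h, fun w => (hh' w).differentiableAt, fun w => ?_⟩
  have hconst : ∀ w, HasDerivAt (fun w => q w * Complex.exp (-h w)) 0 w := by
    intro w
    have := (hq w).hasDerivAt.mul (hh' w).neg.cexp
    convert! this using 1
    field_simp [h0 w]
    ring
  have := is_const_of_deriv_eq_zero (fun w => (hconst w).differentiableAt)
    (fun w => (hconst w).deriv) w 0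
  simp only [h00, Complex.exp_neg, Complex.exp_log (h0 0)] at this
  rw [mul_inv_cancel₀ (h0 0)] at this
  exact (mul_inv_eq_one₀ (Complex.exp_ne_zero _)).mp this

theorem differentiable_dslope {g : ℂ → ℂ} (hg : Differentiable ℂ g) (p : ℂ) :
    Differentiable ℂ (dslope g p) := fun w =>
  ((Complex.differentiableOn_dslope (s := Set.univ) univ_mem).mpr
    hg.differentiableOn).differentiableAt univ_mem

/-- Entire functions with the same zeros, all simple, differ by an exponential factor. -/
theorem exists_eq_exp_mul {g₁ g₂ : ℂ → ℂ} (h₁ : Differentiable ℂ g₁) (h₂ : Differentiable ℂ g₂)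
    (hz : ∀ w, g₁ w = 0 ↔ g₂ w = 0) (hs₁ : ∀ w, g₁ w = 0 → deriv g₁ w ≠ 0)
    (hs₂ : ∀ w, g₂ w = 0 → deriv g₂ w ≠ 0) :
    ∃ h : ℂ → ℂ, Differentiable ℂ h ∧ ∀ w, g₁ w = Complex.exp (h w) * g₂ w := by
  classical
  -- At a common zero the quotient gets its limit, the ratio of the derivatives; near such a point
  -- it is the quotient of the two `dslope`s, hence holomorphic.
  let q : ℂ → ℂ := fun w => if g₂ w = 0 then deriv g₁ w / deriv g₂ w else g₁ w / g₂ w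
  have hq0 : ∀ w, q w ≠ 0 := by
    intro w
    by_cases hw : g₂ w = 0
    · simpa [q, hw] using ⟨hs₁ w ((hz w).2 hw), hs₂ w hw⟩
    · simpa [q, hw] using fun h => hw ((hz w).1 h)
  have hqd : Differentiable ℂ q := by
    intro p
    by_cases hp : g₂ p = 0
    · have hd₂ : dslope g₂ p p ≠ 0 := by simpa using hs₂ p hp
      have hev : ∀ᶠ w in 𝓝 p, dslope g₂ p w ≠ 0 :=
        (differentiable_dslope h₂ p).continuous.continuousAt.eventually_ne hd₂
      have heq : q =ᶠ[𝓝 p] fun w => dslope g₁ p w / dslope g₂ p w := by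
        filter_upwards [hev] with w hw
        by_cases hwp : w = p
        · subst hwp; simp [q, hp]
        · have e₁ := sub_smul_dslope g₁ p w
          have e₂ := sub_smul_dslope g₂ p w
          rw [(hz p).2 hp, sub_zero, smul_eq_mul] at e₁
          rw [hp, sub_zero, smul_eq_mul] at e₂
          have hne : w - p ≠ 0 := sub_ne_zero.2 hwp
          have : g₂ w ≠ 0 := by rw [← e₂]; exact mul_ne_zero hne hw
          simp only [q, this, if_false]
          rw [← e₁, ← e₂, mul_div_mul_left _ _ hne]
      exact (((differentiable_dslope h₁ p) p).div ((differentiable_dslope h₂ p) p)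
        hd₂).congr_of_eventuallyEq heq
    · have heq : q =ᶠ[𝓝 p] fun w => g₁ w / g₂ w := by
        filter_upwards [h₂.continuous.continuousAt.eventually_ne hp] with w hw
        simp [q, hw]
      exact ((h₁ p).div (h₂ p) hp).congr_of_eventuallyEq heq
  obtain ⟨h, hh, he⟩ := exists_exp_eq_of_forall_ne_zero hqd hq0
  refine ⟨h, hh, fun w => ?_⟩
  rw [← he]
  by_cases hw : g₂ w = 0
  · simp [hw, (hz w).2 hw]
  · simp [q, hw]

/-- The zero set is invariant under the lattice, so `g(· + p)` and `g` have the same simple zeros.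
The point is that `log|g|` then changes under the shift by the harmonic function `Re h`. -/
theorem HasSimpleLatticeZeros.add_period {g : ℂ → ℂ} (hg : HasSimpleLatticeZeros g) {p : ℂ}
    (hp : ∃ a b : ℤ, p = a + Complex.I * b) :
    ∃ h : ℂ → ℂ, Differentiable ℂ h ∧ ∀ w, g (w + p) = Complex.exp (h w) * g w := by
  obtain ⟨a, b, rfl⟩ := hp
  obtain ⟨hd, hz, hs⟩ := hg
  refine exists_eq_exp_mul (hd.comp (differentiable_id.add_const _)) hd (fun w => ?_)
    (fun w hw => ?_) hs
  · rw [hz, hz]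
    constructor
    · rintro ⟨c, d, h⟩
      exact ⟨c - a, d - b, by push_cast; linear_combination h⟩
    · rintro ⟨c, d, h⟩
      exact ⟨c + a, d + b, by push_cast; linear_combination h⟩
  · rw [deriv_comp_add_const]
    exact hs _ hw

/-! ### Argument principle on the unit square and the Legendre relation -/

open Complex in
-- A side of the square subtends a quarter turn at the centre. The other three sides are obtained
-- from this one by reflection and rotation.
theorem integral_inv_sub_half_I :
    ∫ x : ℝ in (-(1 / 2))..(1 / 2), ((x : ℂ) - I / 2)⁻¹ = I * (Real.pi / 2) := by
  have hslit : ∀ x : ℝ, (1 / 2 + I * x : ℂ) ∈ slitPlane := fun x => Or.inl (by norm_num)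
  have hne : ∀ x : ℝ, (x : ℂ) - I / 2 ≠ 0 := fun x h => by
    have := congrArg Complex.im h
    norm_num at this
  -- Multiplying `x - i/2` by `i` moves the segment into the right half-plane, where the principal
  -- logarithm is a primitive.
  have hder : ∀ x : ℝ, HasDerivAt (fun x : ℝ => log (1 / 2 + I * x)) ((x : ℂ) - I / 2)⁻¹ x := by
    intro x
    have h1 : HasDerivAt (fun x : ℝ => (1 / 2 + I * x : ℂ)) I x := by
      simpa using (((hasDerivAt_id x).ofReal_comp).const_mul I).const_add (1 / 2 : ℂ)
    convert! h1.clog_real (hslit x) using 1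
    have := slitPlane_ne_zero (hslit x)
    rw [inv_eq_one_div, div_eq_div_iff (hne x) this]
    linear_combination (1 / 2 : ℂ) * I_sq
  have hcont : Continuous fun x : ℝ => ((x : ℂ) - I / 2)⁻¹ :=
    (Complex.continuous_ofReal.sub continuous_const).inv₀ hne
  rw [intervalIntegral.integral_eq_sub_of_hasDerivAt (fun x _ => hder x)
    (hcont.intervalIntegrable _ _)]
  have e : (1 / 2 + I * ((1 / 2 : ℝ) : ℂ)) =
      ((√2 / 2 : ℝ) : ℂ) * exp (((Real.pi / 4 : ℝ) : ℂ) * I) := by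
    rw [exp_mul_I, ← ofReal_cos, ← ofReal_sin, Real.cos_pi_div_four, Real.sin_pi_div_four]
    have : ((√2 : ℝ) : ℂ) * ((√2 : ℝ) : ℂ) = 2 := by
      rw [← ofReal_mul, Real.mul_self_sqrt (by norm_num)]; norm_num
    push_cast
    linear_combination (-(1 / 4) - I / 4) * this
  have e' : (1 / 2 + I * ((-(1 / 2) : ℝ) : ℂ)) =
      (starRingEnd ℂ) (1 / 2 + I * ((1 / 2 : ℝ) : ℂ)) := by
    simp [Complex.conj_ofNat]
  have harg : arg (1 / 2 + I * ((1 / 2 : ℝ) : ℂ)) = Real.pi / 4 := by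
    rw [e, arg_real_mul _ (by positivity), arg_exp_mul_I, toIocMod_eq_self]
    constructor <;> linarith [Real.pi_pos]
  rw [e', log_conj _ (by rw [harg]; linarith [Real.pi_pos]), sub_conj, log_im, harg]
  push_cast
  ring

open Complex in
theorem HasSimpleLatticeZeros.eq_zero_of_abs_le_half {g : ℂ → ℂ} (hg : HasSimpleLatticeZeros g)
    {w : ℂ} (hw : g w = 0) (hre : |w.re| ≤ 1 / 2) (him : |w.im| ≤ 1 / 2) : w = 0 := by
  obtain ⟨p, q, rfl⟩ := (hg.2.1 w).1 hw
  have aux : ∀ n : ℤ, |(n : ℝ)| ≤ 1 / 2 → n = 0 := fun n hn => by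
    rw [← Int.cast_abs] at hn
    have : (|n| : ℝ) < 1 := by push_cast at hn; linarith
    exact Int.abs_lt_one_iff.1 (by exact_mod_cast this)
  have hp := aux p (by simpa using hre)
  have hq := aux q (by simpa using him)
  simp [hp, hq]

open Complex in
-- The square is centred at the origin so that no zero meets its boundary and `0` is the only one
-- inside. Writing `g = w k`, the term `k'/k` integrates to zero by Cauchy, and `1/w` gives four
-- quarter turns.
theorem HasSimpleLatticeZeros.integral_boundary_logDeriv {g : ℂ → ℂ}
    (hg : HasSimpleLatticeZeros g) :
    (∫ x : ℝ in (-(1 / 2))..(1 / 2), deriv g (x - I / 2) / g (x - I / 2)) -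
      (∫ x : ℝ in (-(1 / 2))..(1 / 2), deriv g (x + I / 2) / g (x + I / 2)) +
      I * (∫ y : ℝ in (-(1 / 2))..(1 / 2), deriv g (1 / 2 + y * I) / g (1 / 2 + y * I)) -
      I * (∫ y : ℝ in (-(1 / 2))..(1 / 2), deriv g (-(1 / 2) + y * I) / g (-(1 / 2) + y * I)) =
    2 * Real.pi * I := by
  have hg0 : g 0 = 0 := (hg.2.1 0).2 ⟨0, 0, by simp⟩
  set k := dslope g 0 with hk
  have hkd : Differentiable ℂ k := differentiable_dslope hg.1 0
  have hgk : ∀ w, g w = w * k w := fun w => by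
    have := sub_smul_dslope g 0 w
    simpa [hg0] using this.symm
  have hk0 : ∀ w : ℂ, |w.re| ≤ 1 / 2 → |w.im| ≤ 1 / 2 → k w ≠ 0 := by
    intro w h1 h2 h
    have hw : w = 0 := hg.eq_zero_of_abs_le_half (by rw [hgk, h, mul_zero]) h1 h2
    subst hw
    rw [hk, dslope_same] at h
    exact hg.2.2 0 hg0 h
  have hk' : Differentiable ℂ (deriv k) := fun w =>
    ((hkd.differentiableOn (s := Set.univ)).deriv isOpen_univ).differentiableAt univ_mem
  have hsplit : ∀ w : ℂ, w ≠ 0 → |w.re| ≤ 1 / 2 → |w.im| ≤ 1 / 2 →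
      deriv g w / g w = w⁻¹ + deriv k w / k w := by
    intro w hw h1 h2
    have hd : deriv g w = k w + w * deriv k w := by
      have : g = fun w => w * k w := funext hgk
      rw [this]
      have := ((hasDerivAt_id w).mul (hkd w).hasDerivAt).deriv
      simpa [Pi.mul_def] using this
    have := hk0 w h1 h2
    rw [hd, hgk]
    field_simp
  have hrect := integral_boundary_rect_eq_zero_of_differentiableOn (fun w => deriv k w / k w)
    (-(1 / 2) - I / 2) (1 / 2 + I / 2) (by
      intro w hw
      have h1 := hw.1
      have h2 := hw.2
      norm_num [Set.mem_uIcc] at h1 h2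
      refine ((hk' w).div (hkd w) (hk0 w ?_ ?_)).differentiableWithinAt <;>
        rw [abs_le] <;> constructor <;> grind)
  have c1 : ∀ s : ℂ, s.im = 1 / 2 ∨ s.im = -(1 / 2) → s.re = 0 →
      (∫ x : ℝ in (-(1 / 2))..(1 / 2), deriv g (x + s) / g (x + s)) =
        (∫ x : ℝ in (-(1 / 2))..(1 / 2), ((x : ℂ) + s)⁻¹) +
        ∫ x : ℝ in (-(1 / 2))..(1 / 2), deriv k (x + s) / k (x + s) := by
    intro s hs hsr
    have hs' : |s.im| ≤ 1 / 2 := by rcases hs with h | h <;> rw [h] <;> norm_num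
    have hne : ∀ x : ℝ, (x : ℂ) + s ≠ 0 := fun x h => by
      have := congrArg Complex.im h
      rcases hs with hs | hs <;> norm_num [hs] at this
    rw [← intervalIntegral.integral_add]
    · refine intervalIntegral.integral_congr fun x hx => ?_
      rw [Set.uIcc_of_le (by norm_num)] at hx
      exact hsplit _ (hne x) (by simpa [hsr, abs_le] using hx) (by simpa using hs')
    · exact ((continuous_ofReal.add continuous_const).inv₀ hne).intervalIntegrable _ _
    · refine ContinuousOn.intervalIntegrable ?_
      refine ContinuousOn.div (hk'.continuous.comp (by fun_prop)).continuousOn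
        (hkd.continuous.comp (by fun_prop)).continuousOn fun x hx => ?_
      rw [Set.uIcc_of_le (by norm_num)] at hx
      exact hk0 _ (by simpa [hsr, abs_le] using hx) (by simpa using hs')
  have c2 : ∀ s : ℂ, s.re = 1 / 2 ∨ s.re = -(1 / 2) → s.im = 0 →
      (∫ y : ℝ in (-(1 / 2))..(1 / 2), deriv g (s + y * I) / g (s + y * I)) =
        (∫ y : ℝ in (-(1 / 2))..(1 / 2), (s + (y : ℂ) * I)⁻¹) +
        ∫ y : ℝ in (-(1 / 2))..(1 / 2), deriv k (s + y * I) / k (s + y * I) := by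
    intro s hs hsr
    have hs' : |s.re| ≤ 1 / 2 := by rcases hs with h | h <;> rw [h] <;> norm_num
    have hne : ∀ y : ℝ, s + (y : ℂ) * I ≠ 0 := fun x h => by
      have := congrArg Complex.re h
      rcases hs with hs | hs <;> norm_num [hs] at this
    rw [← intervalIntegral.integral_add]
    · refine intervalIntegral.integral_congr fun x hx => ?_
      rw [Set.uIcc_of_le (by norm_num)] at hx
      exact hsplit _ (hne x) (by simpa using hs') (by simpa [hsr, abs_le] using hx)
    · exact ((by fun_prop : Continuous fun y : ℝ => s + (y : ℂ) * I).inv₀ hne).intervalIntegrable _ _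
    · refine ContinuousOn.intervalIntegrable ?_
      refine ContinuousOn.div (hk'.continuous.comp (by fun_prop)).continuousOn
        (hkd.continuous.comp (by fun_prop)).continuousOn fun x hx => ?_
      rw [Set.uIcc_of_le (by norm_num)] at hx
      exact hk0 _ (by simpa using hs') (by simpa [hsr, abs_le] using hx)
  have d1 := c1 (-(I / 2)) (by norm_num) (by norm_num)
  have d2 := c1 (I / 2) (by norm_num) (by norm_num)
  have d3 := c2 (1 / 2) (by norm_num) (by norm_num)
  have d4 := c2 (-(1 / 2)) (by norm_num) (by norm_num)
  have J := integral_inv_sub_half_I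
  have J2 : ∫ x : ℝ in (-(1 / 2))..(1 / 2), ((x : ℂ) + I / 2)⁻¹ = -(I * (Real.pi / 2)) := by
    rw [← J, ← intervalIntegral.integral_neg]
    have := intervalIntegral.integral_comp_neg (a := -(1 / 2)) (b := 1 / 2)
      (fun x : ℝ => ((x : ℂ) + I / 2)⁻¹)
    rw [neg_neg] at this
    rw [← this]
    refine intervalIntegral.integral_congr fun x _ => ?_
    rw [← inv_neg]
    push_cast
    ring_nf
  have J3 : I * ∫ y : ℝ in (-(1 / 2))..(1 / 2), (1 / 2 + (y : ℂ) * I)⁻¹ = I * (Real.pi / 2) := by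
    rw [← J, ← intervalIntegral.integral_const_mul]
    refine intervalIntegral.integral_congr fun x _ => ?_
    have : (1 / 2 + (x : ℂ) * I) = I * (x - I / 2) := by linear_combination (1 / 2) * I_sq
    rw [this, mul_inv, mul_inv_cancel_left₀ I_ne_zero]
  have J4 : I * ∫ y : ℝ in (-(1 / 2))..(1 / 2), (-(1 / 2) + (y : ℂ) * I)⁻¹ =
      -(I * (Real.pi / 2)) := by
    rw [← J2, ← intervalIntegral.integral_const_mul]
    refine intervalIntegral.integral_congr fun x _ => ?_
    have : (-(1 / 2) + (x : ℂ) * I) = I * (x + I / 2) := by linear_combination (-1 / 2) * I_sq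
    rw [this, mul_inv, mul_inv_cancel_left₀ I_ne_zero]
  have r1 : (-(1 / 2) - I / 2 : ℂ).re = -(1 / 2) := by norm_num
  have r2 : (-(1 / 2) - I / 2 : ℂ).im = -(1 / 2) := by norm_num
  have r3 : (1 / 2 + I / 2 : ℂ).re = 1 / 2 := by norm_num
  have r4 : (1 / 2 + I / 2 : ℂ).im = 1 / 2 := by norm_num
  have r5 : ((1 / 2 : ℝ) : ℂ) = 1 / 2 := by norm_num
  have r6 : (1 / 2 : ℂ) * I = I / 2 := by ring
  simp only [r1, r2, r3, r4, ofReal_neg, r5, neg_mul, r6, smul_eq_mul] at hrect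
  simp only [sub_eq_add_neg] at J hrect d1 d2 d3 d4 ⊢
  rw [d1, d2, d3, d4, J, J2]
  linear_combination hrect + J3 - J4

open Complex in
/-- The Legendre relation for the quasi-periods of a function with simple lattice zeros. -/
theorem HasSimpleLatticeZeros.legendre {g h₁ h₂ : ℂ → ℂ} (hg : HasSimpleLatticeZeros g)
    (hd₁ : Differentiable ℂ h₁) (hd₂ : Differentiable ℂ h₂)
    (he₁ : ∀ w, g (w + 1) = exp (h₁ w) * g w) (he₂ : ∀ w, g (w + I) = exp (h₂ w) * g w) (w : ℂ) :
    h₁ (w + I) - h₁ w - (h₂ (w + 1) - h₂ w) = 2 * Real.pi * I := by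
  have hlog : ∀ (h : ℂ → ℂ) (p : ℂ), Differentiable ℂ h → (∀ w, g (w + p) = exp (h w) * g w) →
      ∀ w, g w ≠ 0 → deriv g (w + p) / g (w + p) = deriv g w / g w + deriv h w := by
    intro h p hd he w hw
    have h1 : deriv g (w + p) = exp (h w) * deriv h w * g w + exp (h w) * deriv g w := by
      rw [← deriv_comp_add_const]
      have : (fun x => g (x + p)) = fun w => exp (h w) * g w := funext he
      rw [this]
      have := ((hd w).hasDerivAt.cexp.mul (hg.1 w).hasDerivAt).deriv
      simpa [Pi.mul_def] using this
    rw [h1, he]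
    have := exp_ne_zero (h w)
    field_simp
    ring
  have hl₁ := hlog h₁ 1 hd₁ he₁
  have hl₂ := hlog h₂ I hd₂ he₂
  have hper : ∀ (h : ℂ → ℂ) (p : ℂ), (∀ w, g (w + p) = exp (h w) * g w) →
      ∀ w, g w ≠ 0 → g (w + p) ≠ 0 := fun h p he w hw => by
    rw [he]; exact mul_ne_zero (exp_ne_zero _) hw
  have hc : ∀ {h : ℂ → ℂ}, Differentiable ℂ h → Continuous (deriv h) := fun {h} hd =>
    ((hd.contDiff (n := 1)).continuous_deriv le_rfl)
  set Λ : ℂ → ℂ := fun w => h₁ (w + I) - h₁ w - (h₂ (w + 1) - h₂ w) with hΛ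
  have hΛd : Differentiable ℂ Λ := by fun_prop
  have hΛ' : ∀ w, deriv Λ w = deriv h₁ (w + I) - deriv h₁ w - (deriv h₂ (w + 1) - deriv h₂ w) := by
    intro w
    have a1 := ((hd₁ (w + I)).hasDerivAt.comp_add_const w I)
    have a2 := ((hd₂ (w + 1)).hasDerivAt.comp_add_const w 1)
    exact ((a1.sub (hd₁ w).hasDerivAt).sub (a2.sub (hd₂ w).hasDerivAt)).deriv
  -- Off the zeros, `Λ' = 0` because the logarithmic derivative reaches `w + 1 + i` by either order
  -- of shifts. Continuity and density extend this to all points, so `Λ` is constant and may be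
  -- evaluated at a corner of the square.
  have hdense : Dense {w | g w ≠ 0} := by
    have hsub : {w | g w ≠ 0}ᶜ ⊆ Set.range fun p : ℤ × ℤ => (p.1 + I * p.2 : ℂ) := by
      intro w hw
      obtain ⟨p, q, h⟩ := (hg.2.1 w).1 (not_not.1 hw)
      exact ⟨(p, q), h.symm⟩
    have := ((Set.countable_range _).mono hsub).dense_compl ℝ
    rwa [compl_compl] at this
  have hΛ0 : ∀ w, deriv Λ w = 0 := by
    have : deriv Λ = 0 := by
      refine Continuous.ext_on hdense (hc hΛd) continuous_zero fun w hw => ?_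
      have e1 := hl₁ w hw
      have e2 := hl₂ w hw
      have e3 := hl₁ (w + I) (hper h₂ I he₂ w hw)
      have e4 := hl₂ (w + 1) (hper h₁ 1 he₁ w hw)
      rw [add_right_comm] at e3
      rw [hΛ']
      simp only [Pi.zero_apply]
      linear_combination -e3 + e4 + e1 - e2
    exact fun w => congrFun this w
  have hconst : Λ w = Λ (-(1 / 2) - I / 2) := is_const_of_deriv_eq_zero hΛd hΛ0 _ _
  have hb := hg.integral_boundary_logDeriv
  have hne : ∀ w : ℂ, |w.re| ≤ 1 / 2 → |w.im| ≤ 1 / 2 → w ≠ 0 → g w ≠ 0 := fun w h1 h2 h0 h =>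
    h0 (hg.eq_zero_of_abs_le_half h h1 h2)
  have hn1 : ∀ x : ℝ, x ∈ Set.uIcc (-(1 / 2) : ℝ) (1 / 2) → g (x - I / 2) ≠ 0 := by
    intro x hx
    rw [Set.uIcc_of_le (by norm_num)] at hx
    refine hne _ (by simpa [abs_le] using hx) (by norm_num [abs_le]) fun h => ?_
    have := congrArg Complex.im h
    norm_num at this
  have hn2 : ∀ x : ℝ, x ∈ Set.uIcc (-(1 / 2) : ℝ) (1 / 2) → g (-(1 / 2) + x * I) ≠ 0 := by
    intro x hx
    rw [Set.uIcc_of_le (by norm_num)] at hx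
    refine hne _ (by norm_num [abs_le]) (by simpa [abs_le] using hx) fun h => ?_
    have := congrArg Complex.re h
    norm_num at this
  -- Opposite sides differ by a period, so their contributions to the boundary integral differ by an
  -- increment of `h₂`, respectively `h₁`. These increments add up to `Λ` at the lower left corner.
  have i1 : (∫ x : ℝ in (-(1 / 2))..(1 / 2), deriv g (x + I / 2) / g (x + I / 2)) =
      (∫ x : ℝ in (-(1 / 2))..(1 / 2), deriv g (x - I / 2) / g (x - I / 2)) +
      (h₂ (1 / 2 - I / 2) - h₂ (-(1 / 2) - I / 2)) := by
    have hF : ∀ x : ℝ, HasDerivAt (fun x : ℝ => h₂ (x - I / 2)) (deriv h₂ (x - I / 2)) x := by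
      intro x
      have := (hd₂ (x - I / 2)).hasDerivAt.comp_sub_const (x : ℂ) (I / 2)
      exact this.comp_ofReal
    have := intervalIntegral.integral_eq_sub_of_hasDerivAt (a := -(1 / 2)) (b := 1 / 2)
      (fun x _ => hF x)
      (((hc hd₂).comp (by fun_prop)).intervalIntegrable _ _)
    push_cast at this
    rw [← this, ← intervalIntegral.integral_add]
    · refine intervalIntegral.integral_congr fun x hx => ?_
      have := hl₂ _ (hn1 x hx)
      rw [show (x : ℂ) - I / 2 + I = x + I / 2 by ring] at this
      exact this
    · refine ContinuousOn.intervalIntegrable (ContinuousOn.div ?_ ?_ hn1)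
      · exact ((hc hg.1).comp (by fun_prop)).continuousOn
      · exact (hg.1.continuous.comp (by fun_prop)).continuousOn
    · exact ((hc hd₂).comp (by fun_prop)).intervalIntegrable _ _
  have i2 : I * (∫ x : ℝ in (-(1 / 2))..(1 / 2), deriv g (1 / 2 + x * I) / g (1 / 2 + x * I)) =
      I * (∫ x : ℝ in (-(1 / 2))..(1 / 2), deriv g (-(1 / 2) + x * I) / g (-(1 / 2) + x * I)) +
      (h₁ (-(1 / 2) + I / 2) - h₁ (-(1 / 2) - I / 2)) := by
    have hF : ∀ x : ℝ, HasDerivAt (fun x : ℝ => h₁ (-(1 / 2) + x * I))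
        (I * deriv h₁ (-(1 / 2) + x * I)) x := by
      intro x
      have h2 : HasDerivAt (fun x : ℝ => (-(1 / 2) + x * I : ℂ)) I x := by
        simpa using (((hasDerivAt_id x).ofReal_comp).mul_const I).const_add (-(1 / 2) : ℂ)
      have := (hd₁ (-(1 / 2) + x * I)).hasDerivAt.comp x h2
      rw [mul_comm]
      exact this
    have := intervalIntegral.integral_eq_sub_of_hasDerivAt (a := -(1 / 2)) (b := 1 / 2)
      (fun x _ => hF x)
      ((continuous_const.mul ((hc hd₁).comp (by fun_prop))).intervalIntegrable _ _)
    rw [intervalIntegral.integral_const_mul] at this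
    have e : h₁ (-(1 / 2) + I / 2) - h₁ (-(1 / 2) - I / 2) =
        h₁ (-(1 / 2) + ((1 / 2 : ℝ) : ℂ) * I) - h₁ (-(1 / 2) + ((-(1 / 2) : ℝ) : ℂ) * I) := by
      push_cast; ring_nf
    rw [e, ← this, ← mul_add, ← intervalIntegral.integral_add]
    · congr 1
      refine intervalIntegral.integral_congr fun x hx => ?_
      have := hl₁ _ (hn2 x hx)
      rw [show -(1 / 2) + (x : ℂ) * I + 1 = 1 / 2 + x * I by ring] at this
      exact this
    · refine ContinuousOn.intervalIntegrable (ContinuousOn.div ?_ ?_ hn2)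
      · exact ((hc hg.1).comp (by fun_prop)).continuousOn
      · exact (hg.1.continuous.comp (by fun_prop)).continuousOn
    · exact ((hc hd₁).comp (by fun_prop)).intervalIntegrable _ _
  rw [i1, i2] at hb
  change Λ w = _
  rw [hconst, ← hb, hΛ]
  ring_nf

/-! ### Local integrability of `log|g|` and of its pullbacks -/

theorem ae_re_ne_zero : ∀ᵐ w : ℂ, w.re ≠ 0 := by
  have h : ∀ᵐ p : ℝ × ℝ, p.1 ≠ 0 :=
    (Measure.quasiMeasurePreserving_fst (μ := (volume : Measure ℝ)) (ν := (volume : Measure ℝ))).ae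
      (Measure.ae_ne volume 0)
  exact Complex.volume_preserving_equiv_real_prod.quasiMeasurePreserving.ae h

/-- On a box of half-width `R`, `|log ‖w‖|` is at most `|log|Re w|| + 2R` off the line `Re w = 0`;
this reduces the claim to the integrability of the real logarithm. -/
theorem locallyIntegrable_log_norm : LocallyIntegrable fun w : ℂ => Real.log ‖w‖ := by
  have hm : Measurable fun w : ℂ => Real.log ‖w‖ := Real.measurable_log.comp measurable_norm
  intro p
  set R : ℝ := ‖p‖ + 1
  refine ⟨Complex.measurableEquivRealProd ⁻¹' (Set.Ioc (-R) R ×ˢ Set.Ioc (-R) R), ?_, ?_⟩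
  · refine Filter.mem_of_superset (Metric.ball_mem_nhds p one_pos) fun w hw => ?_
    have hw' : ‖w‖ < R := by
      have : ‖w - p‖ < 1 := by simpa [dist_eq_norm] using hw
      linarith [norm_sub_norm_le w p]
    have h1 := abs_lt.1 ((Complex.abs_re_le_norm w).trans_lt hw')
    have h2 := abs_lt.1 ((Complex.abs_im_le_norm w).trans_lt hw')
    exact ⟨⟨h1.1, h1.2.le⟩, ⟨h2.1, h2.2.le⟩⟩
  · have hdom : IntegrableOn (fun w : ℂ => |Real.log w.re| + 2 * R)
        (Complex.measurableEquivRealProd ⁻¹' (Set.Ioc (-R) R ×ˢ Set.Ioc (-R) R)) := by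
      have h1 : IntegrableOn (fun p : ℝ × ℝ => |Real.log p.1| + 2 * R)
          (Set.Ioc (-R) R ×ˢ Set.Ioc (-R) R) := by
        rw [IntegrableOn, Measure.volume_eq_prod, ← Measure.prod_restrict]
        have : IntegrableOn (fun x : ℝ => |Real.log x| + 2 * R) (Set.Ioc (-R) R) :=
          ((intervalIntegral.intervalIntegrable_log' (a := -R) (b := R)).1.abs).add
            (integrableOn_const (by simp))
        exact Integrable.comp_fst this _
      exact (Complex.volume_preserving_equiv_real_prod.integrableOn_comp_preimage
        Complex.measurableEquivRealProd.measurableEmbedding).2 h1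
    refine hdom.mono' hm.aestronglyMeasurable ?_
    have hms : MeasurableSet (Complex.measurableEquivRealProd ⁻¹'
        (Set.Ioc (-R) R ×ˢ Set.Ioc (-R) R)) :=
      Complex.measurableEquivRealProd.measurable (measurableSet_Ioc.prod measurableSet_Ioc)
    refine (ae_restrict_iff' hms).2 ?_
    filter_upwards [ae_re_ne_zero] with w hw hwR
    have h1 : |w.re| ≤ R := abs_le.2 ⟨hwR.1.1.le, hwR.1.2⟩
    have h2 : |w.im| ≤ R := abs_le.2 ⟨hwR.2.1.le, hwR.2.2⟩
    have h0 : 0 < |w.re| := abs_pos.2 hw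
    have h3 : |w.re| ≤ ‖w‖ := Complex.abs_re_le_norm w
    have h4 : Real.log ‖w‖ ≤ ‖w‖ := Real.log_le_self (norm_nonneg _)
    have h5 : ‖w‖ ≤ |w.re| + |w.im| := Complex.norm_le_abs_re_add_abs_im w
    have h6 : Real.log |w.re| ≤ Real.log ‖w‖ := Real.log_le_log h0 h3
    rw [Real.log_abs] at h6
    rw [Real.norm_eq_abs, abs_le]
    constructor
    · linarith [neg_abs_le (Real.log w.re)]
    · linarith [abs_nonneg (Real.log w.re)]

/-- Near a zero `p`, `log|g|` splits as `log|w - p|` plus the logarithm of `|dslope g p w|`, which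
is continuous at `p` because the zero is simple. -/
theorem locallyIntegrable_log_norm_of_simple_zeros {g : ℂ → ℂ} (hd : Differentiable ℂ g)
    (hs : ∀ w, g w = 0 → deriv g w ≠ 0) : LocallyIntegrable fun w : ℂ => Real.log ‖g w‖ := by
  have hcont : ∀ k : ℂ → ℂ, Differentiable ℂ k → ∀ p, k p ≠ 0 →
      IntegrableAtFilter (fun w => Real.log ‖k w‖) (𝓝 p) volume := by
    intro k hk p hp
    have hm : Measurable fun w => Real.log ‖k w‖ :=
      Real.measurable_log.comp (measurable_norm.comp hk.continuous.measurable)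
    refine Measure.FiniteAtFilter.integrableAtFilter_of_tendsto
      (b := Real.log ‖k p‖) ⟨Set.univ, univ_mem, hm.aestronglyMeasurable⟩
      (Measure.finiteAt_nhds volume p) ?_
    exact (hk.continuous.continuousAt.norm.log (norm_ne_zero_iff.2 hp)).tendsto
  intro p
  by_cases hp : g p = 0
  · have hk : dslope g p p ≠ 0 := by simpa using hs p hp
    have h1 := hcont _ (differentiable_dslope hd p) p hk
    have h2 : IntegrableAtFilter (fun w : ℂ => Real.log ‖w - p‖) (𝓝 p) volume := by
      have := (locallyIntegrable_map_homeomorph (Homeomorph.subRight p) (μ := volume)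
        (f := fun w : ℂ => Real.log ‖w‖)).1 (by
          change LocallyIntegrable _ (Measure.map (fun x => x - p) volume)
          rw [map_sub_right_eq_self]
          exact locallyIntegrable_log_norm)
      exact this p
    obtain ⟨s, hs, his⟩ := h2.add h1
    have hev := (differentiable_dslope hd p).continuous.continuousAt.eventually_ne hk
    obtain ⟨t, ht, hto, htp⟩ := eventually_nhds_iff.1 hev
    refine ⟨s ∩ t, Filter.inter_mem hs (hto.mem_nhds htp), ?_⟩
    refine (his.mono_set Set.inter_subset_left).congr_fun_ae ?_
    have hae : ∀ᵐ w : ℂ ∂(volume.restrict (s ∩ t)), w ∈ t := by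
      have : ∀ᵐ w : ℂ ∂(volume.restrict t), w ∈ t := ae_restrict_mem hto.measurableSet
      exact ae_mono (Measure.restrict_mono Set.inter_subset_right le_rfl) this
    have hne : ∀ᵐ w : ℂ ∂(volume.restrict (s ∩ t)), w ≠ p :=
      ae_restrict_of_ae (Measure.ae_ne volume p)
    filter_upwards [hae, hne] with w hw hwp
    have e := sub_smul_dslope g p w
    rw [hp, sub_zero, smul_eq_mul] at e
    rw [← e, norm_mul, Real.log_mul (norm_ne_zero_iff.2 (sub_ne_zero.2 hwp))
      (norm_ne_zero_iff.2 (ht w hw))]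
    rfl
  · exact hcont g hd p hp

theorem locallyIntegrable_comp_eval {m : ℕ} {V : ℂ → ℝ} (hV : LocallyIntegrable V) (k : Fin m) :
    LocallyIntegrable fun z : Fin m → ℂ => V (z k) := by
  intro z
  refine ⟨Set.univ.pi fun i => Metric.closedBall (z i) 1,
    set_pi_mem_nhds Set.finite_univ fun i _ => Metric.closedBall_mem_nhds _ one_pos, ?_⟩
  rw [IntegrableOn, volume_pi, Measure.restrict_pi_pi]
  have : ∀ i, IsFiniteMeasure ((volume : Measure ℂ).restrict (Metric.closedBall (z i) 1)) :=
    fun i => ⟨by simp⟩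
  exact integrable_comp_eval (i := k)
    (hV.integrableOn_isCompact (isCompact_closedBall (z k) 1))

theorem exists_single_ne_zero {m : ℕ} {L : (Fin m → ℂ) →L[ℂ] ℂ} (hL : L ≠ 0) :
    ∃ k, L (Pi.single k 1) ≠ 0 := by
  by_contra! h
  exact hL (ContinuousLinearMap.coe_injective (LinearMap.pi_ext' fun i =>
    LinearMap.ext_ring (by simpa using h i)))

/-- A locally integrable function on `ℂ` pulls back along a nonzero linear form to a locally
integrable function. -/
theorem locallyIntegrable_comp_linear {m : ℕ} {V : ℂ → ℝ} (hV : LocallyIntegrable V)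
    {L : (Fin m → ℂ) →L[ℂ] ℂ} (hL : L ≠ 0) :
    LocallyIntegrable fun z : Fin m → ℂ => V (L z) := by
  obtain ⟨k, hk⟩ := exists_single_ne_zero hL
  set c := L (Pi.single k 1) with hc
  have hLs : ∀ a : ℂ, L (Pi.single k a) = a * c := fun a => by
    rw [hc, ← smul_eq_mul, ← map_smul, ← Pi.single_smul, smul_eq_mul, mul_one]
  have hcont : ∀ {f : (Fin m → ℂ) → ℂ}, Continuous f →
      Continuous fun z => (Pi.single k (f z) : Fin m → ℂ) := fun hf =>
    (continuous_single k).comp hf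
  -- The linear change of variables that replaces the `k`-th coordinate by `L z`; it is invertible
  -- because `c ≠ 0`.
  let e : (Fin m → ℂ) ≃ₜ (Fin m → ℂ) :=
    { toFun := fun z => z + Pi.single k (L z - z k)
      invFun := fun z => z + Pi.single k ((z k - L z) / c)
      left_inv := fun z => by
        simp only [map_add, hLs, Pi.add_apply, Pi.single_eq_same, add_assoc, ← Pi.single_add]
        have : L z - z k + (z k + (L z - z k) - (L z + (L z - z k) * c)) / c = 0 := by
          field_simp; ring
        rw [this, Pi.single_zero, add_zero]
      right_inv := fun z => by
        simp only [map_add, hLs, Pi.add_apply, Pi.single_eq_same, add_assoc, ← Pi.single_add]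
        have : (z k - L z) / c + (L z + (z k - L z) / c * c - (z k + (z k - L z) / c)) = 0 := by
          field_simp; ring
        rw [this, Pi.single_zero, add_zero]
      continuous_toFun := by
        have := hcont (f := fun z => L z - z k) (by fun_prop)
        exact continuous_id.add this
      continuous_invFun := by
        have := hcont (f := fun z => (z k - L z) / c) (by fun_prop)
        exact continuous_id.add this }
  let ea : (Fin m → ℂ) ≃+ (Fin m → ℂ) :=
    { e.toEquiv with
      map_add' := fun z w => by
        change z + w + Pi.single k (L (z + w) - (z + w) k) =
          (z + Pi.single k (L z - z k)) + (w + Pi.single k (L w - w k))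
        rw [map_add, Pi.add_apply, add_sub_add_comm, Pi.single_add]
        abel }
  -- By uniqueness of Haar measure no Jacobian is needed: the image of the volume is a multiple of
  -- the volume.
  have : (Measure.map e volume).IsAddHaarMeasure :=
    ea.isAddHaarMeasure_map volume e.continuous e.symm.continuous
  have hloc : LocallyIntegrable (fun z : Fin m → ℂ => V (z k)) (Measure.map e volume) := by
    rw [Measure.isAddLeftInvariant_eq_smul (Measure.map e volume) volume]
    intro z
    obtain ⟨s, hs, hi⟩ := locallyIntegrable_comp_eval hV k z
    refine ⟨s, hs, ?_⟩
    rw [IntegrableOn, Measure.restrict_smul]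
    exact Integrable.smul_measure_nnreal hi
  have := (locallyIntegrable_map_homeomorph e).1 hloc
  refine this.congr (ae_of_all _ fun z => ?_)
  simp [e]

/-! ### Cell averages, and the cell average of `log|g|` -/

open Complex in
theorem locallyIntegrable_comp_equivRealProd_symm {V : ℂ → ℝ} (hV : LocallyIntegrable V) :
    LocallyIntegrable fun p : ℝ × ℝ => V (p.1 + p.2 * I) := by
  have hmp := volume_preserving_equiv_real_prod.symm
  have hfun : ∀ p : ℝ × ℝ, measurableEquivRealProd.symm p = p.1 + p.2 * I := fun p => by
    rw [measurableEquivRealProd_symm_apply, mk_eq_add_mul_I]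
  intro p
  obtain ⟨s, hs, hi⟩ := hV (p.1 + p.2 * I)
  refine ⟨measurableEquivRealProd.symm ⁻¹' s, ?_, ?_⟩
  · have : Continuous fun p : ℝ × ℝ => (p.1 + p.2 * I : ℂ) := by fun_prop
    have h2 := this.continuousAt (x := p) hs
    refine Filter.mem_of_superset h2 fun q hq => ?_
    simpa only [Set.mem_preimage, hfun] using hq
  · have := (hmp.integrableOn_comp_preimage
      measurableEquivRealProd.symm.measurableEmbedding).2 hi
    refine this.congr (ae_of_all _ fun q => ?_)
    simp only [Function.comp, hfun]

theorem integrable_prod_Ioc {V : ℝ × ℝ → ℝ} (hV : LocallyIntegrable V)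
    (a b c d : ℝ) : Integrable V
      ((volume.restrict (Set.Ioc a b)).prod (volume.restrict (Set.Ioc c d))) := by
  rw [Measure.prod_restrict]
  exact (hV.integrableOn_isCompact (isCompact_Icc.prod isCompact_Icc)).mono_set
    (Set.prod_mono Set.Ioc_subset_Icc_self Set.Ioc_subset_Icc_self)

theorem intervalIntegral_swap_of_locallyIntegrable {V : ℝ × ℝ → ℝ} (hV : LocallyIntegrable V)
    {a b c d : ℝ} (hab : a ≤ b) (hcd : c ≤ d) :
    ∫ x in a..b, ∫ y in c..d, V (x, y) = ∫ y in c..d, ∫ x in a..b, V (x, y) := by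
  simp only [intervalIntegral.integral_of_le hab, intervalIntegral.integral_of_le hcd]
  exact integral_integral_swap (integrable_prod_Ioc hV a b c d)

/-- The change of a double integral over a strip of width one, under a shift. -/
theorem integral_unit_strip_add {V D : ℝ × ℝ → ℝ} (hV : LocallyIntegrable V)
    (hD : ∀ᵐ p : ℝ × ℝ, V (p.1 + 1, p.2) - V p = D p) {a δ c d : ℝ} (hcd : c ≤ d) :
    ∫ x in (a + δ)..(a + δ + 1), ∫ y in c..d, V (x, y) =
      (∫ x in a..(a + 1), ∫ y in c..d, V (x, y)) + ∫ x in a..(a + δ), ∫ y in c..d, D (x, y) := by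
  set j : ℝ → ℝ := fun x => ∫ y in c..d, V (x, y) with hj
  have hji : ∀ a b, IntervalIntegrable j volume a b := by
    have aux : ∀ a b, IntegrableOn j (Set.Ioc a b) := by
      intro a b
      have := (integrable_prod_Ioc hV a b c d).integral_prod_left
      simpa only [hj, intervalIntegral.integral_of_le hcd] using! this
    exact fun a b => ⟨aux a b, aux b a⟩
  -- Fubini on a bounded box gives integrable slices for almost every `x` in it; the intervals `(-n,
  -- n]` exhaust the line.
  have hslice : ∀ᵐ x : ℝ, IntervalIntegrable (fun y => V (x, y)) volume c d := by
    have aux : ∀ n : ℕ, ∀ᵐ x : ℝ, x ∈ Set.Ioc (-(n : ℝ)) n →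
        IntervalIntegrable (fun y => V (x, y)) volume c d := fun n => by
      rw [← ae_restrict_iff' measurableSet_Ioc]
      filter_upwards [(integrable_prod_Ioc hV (-(n : ℝ)) n c d).prod_right_ae] with x hx
      exact (intervalIntegrable_iff_integrableOn_Ioc_of_le hcd).2 hx
    filter_upwards [ae_all_iff.2 aux] with x hx
    obtain ⟨n, hn⟩ := exists_nat_gt |x|
    exact hx n ⟨(abs_lt.1 hn).1, (abs_lt.1 hn).2.le⟩
  have hslice1 : ∀ᵐ x : ℝ, IntervalIntegrable (fun y => V (x + 1, y)) volume c d :=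
    (measurePreserving_add_right volume (1 : ℝ)).quasiMeasurePreserving.ae hslice
  have hDs : ∀ᵐ x : ℝ, ∀ᵐ y : ℝ, V (x + 1, y) - V (x, y) = D (x, y) :=
    Measure.ae_ae_of_ae_prod hD
  have hjD : ∀ᵐ x : ℝ, j (x + 1) - j x = ∫ y in c..d, D (x, y) := by
    filter_upwards [hslice, hslice1, hDs] with x h1 h2 h3
    rw [hj, ← intervalIntegral.integral_sub h2 h1]
    refine intervalIntegral.integral_congr_ae ?_
    filter_upwards [h3] with y hy _ using hy
  have e1 : ∫ x in a..(a + δ), ∫ y in c..d, D (x, y) =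
      (∫ x in (a + 1)..(a + δ + 1), j x) - ∫ x in a..(a + δ), j x := by
    rw [← intervalIntegral.integral_comp_add_right, ← intervalIntegral.integral_sub]
    · refine intervalIntegral.integral_congr_ae ?_
      filter_upwards [hjD] with x hx _ using hx.symm
    · have := (hji (a + 1) (a + δ + 1)).comp_add_right 1
      simpa using this
    · exact hji _ _
  -- The two unit intervals differ by the end pieces `[a + 1, a + δ + 1]` and `[a, a + δ]`, taken
  -- with orientation, so the sign of `δ` does not matter.
  have e2 := intervalIntegral.integral_interval_sub_interval_comm
    (hji (a + δ) (a + δ + 1)) (hji a (a + 1)) (hji (a + δ) a)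
  rw [e1]
  rw [intervalIntegral.integral_symm a (a + δ),
    intervalIntegral.integral_symm (a + 1) (a + δ + 1)] at e2
  linarith

open Complex in
/-- The integral of `V` over the unit square with lower left corner `w`. -/
noncomputable def cellIntegral (V : ℂ → ℝ) (w : ℂ) : ℝ :=
  ∫ x in w.re..(w.re + 1), ∫ y in w.im..(w.im + 1), V (x + y * I)

open Complex in
theorem cellIntegral_comp_add (V : ℂ → ℝ) (w : ℂ) :
    cellIntegral (fun s => V (w + s)) 0 = cellIntegral V w := by
  have h1 := intervalIntegral.integral_comp_add_left (a := 0) (b := 1)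
    (fun x : ℝ => ∫ y in w.im..(w.im + 1), V (x + y * I)) w.re
  have h2 : ∀ x : ℝ, (∫ y in (0 : ℝ)..1, V (w + (x + y * I))) =
      ∫ y in w.im..(w.im + 1), V ((w.re + x : ℝ) + y * I) := fun x => by
    have := intervalIntegral.integral_comp_add_left (a := 0) (b := 1)
      (fun y : ℝ => V ((w.re + x : ℝ) + y * I)) w.im
    rw [add_zero] at this
    rw [← this]
    refine intervalIntegral.integral_congr fun y _ => ?_
    congr 1
    conv_lhs => rw [← re_add_im w]
    push_cast
    ring
  rw [add_zero] at h1
  simp only [cellIntegral, zero_re, zero_im, zero_add]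
  rw [← h1]
  exact intervalIntegral.integral_congr fun x _ => h2 x

theorem ae_comp_equivRealProd_symm {P : ℂ → Prop} (h : ∀ᵐ w, P w) :
    ∀ᵐ p : ℝ × ℝ, P (p.1 + p.2 * Complex.I) := by
  have := Complex.volume_preserving_equiv_real_prod.symm.quasiMeasurePreserving.ae h
  simpa only [Complex.measurableEquivRealProd_symm_apply, Complex.mk_eq_add_mul_I] using! this

theorem HasSimpleLatticeZeros.ae_ne_zero {g : ℂ → ℂ} (hg : HasSimpleLatticeZeros g) :
    ∀ᵐ w, g w ≠ 0 := by
  have hsub : {w | g w ≠ 0}ᶜ ⊆ Set.range fun p : ℤ × ℤ => (p.1 + Complex.I * p.2 : ℂ) := by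
    intro w hw
    obtain ⟨p, q, h⟩ := (hg.2.1 w).1 (not_not.1 hw)
    exact ⟨(p, q), h.symm⟩
  exact ((Set.countable_range _).mono hsub).measure_zero _

theorem HasSimpleLatticeZeros.locallyIntegrable {g : ℂ → ℂ} (hg : HasSimpleLatticeZeros g) :
    LocallyIntegrable fun w => Real.log ‖g w‖ :=
  locallyIntegrable_log_norm_of_simple_zeros hg.1 hg.2.2

theorem log_norm_exp_mul {g h : ℂ → ℂ} {p : ℂ} (he : ∀ w, g (w + p) = Complex.exp (h w) * g w)
    {w : ℂ} (hw : g w ≠ 0) : Real.log ‖g (w + p)‖ - Real.log ‖g w‖ = (h w).re := by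
  rw [he, norm_mul, Complex.norm_exp,
    Real.log_mul (Real.exp_ne_zero _) (norm_ne_zero_iff.2 hw), Real.log_exp, add_sub_cancel_right]

open Complex in
theorem hasDerivAt_comp_horizontal {F : ℂ → ℂ} {F' : ℂ} {b x : ℝ}
    (hF : HasDerivAt F F' (x + b * I)) : HasDerivAt (fun x : ℝ => F (x + b * I)) F' x := by
  have h2 : HasDerivAt (fun x : ℝ => (x + b * I : ℂ)) 1 x := by
    simpa using ((hasDerivAt_id x).ofReal_comp).add_const (b * I : ℂ)
  convert! hF.comp x h2 using 1
  rw [mul_one]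

open Complex in
theorem hasDerivAt_comp_vertical {F : ℂ → ℂ} {F' : ℂ} {a y : ℝ}
    (hF : HasDerivAt F F' (a + y * I)) : HasDerivAt (fun y : ℝ => F (a + y * I)) (F' * I) y := by
  have h2 : HasDerivAt (fun y : ℝ => (a + y * I : ℂ)) I y := by
    simpa using (((hasDerivAt_id y).ofReal_comp).mul_const I).const_add (a : ℂ)
  exact hF.comp y h2

theorem hasDerivAt_re {F : ℝ → ℂ} {F' : ℂ} {x : ℝ} (h : HasDerivAt F F' x) :
    HasDerivAt (fun x => (F x).re) F'.re x :=
  Complex.reCLM.hasFDerivAt.comp_hasDerivAt x h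

theorem hasDerivAt_im {F : ℝ → ℂ} {F' : ℂ} {x : ℝ} (h : HasDerivAt F F' x) :
    HasDerivAt (fun x => (F x).im) F'.im x :=
  Complex.imCLM.hasFDerivAt.comp_hasDerivAt x h

open Complex in
/-- The cell average of `log |g|` is a harmonic function plus `π (Re w)²`. -/
theorem HasSimpleLatticeZeros.cellIntegral_log_norm {g : ℂ → ℂ} (hg : HasSimpleLatticeZeros g) :
    ∃ K : ℂ → ℂ, Differentiable ℂ K ∧
      ∀ w, cellIntegral (fun s => Real.log ‖g s‖) w = (K w).re + Real.pi * w.re ^ 2 := by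
  obtain ⟨h₁, hd₁, he₁⟩ := hg.add_period (p := 1) ⟨1, 0, by simp⟩
  obtain ⟨h₂, hd₂, he₂⟩ := hg.add_period (p := I) ⟨0, 1, by simp⟩
  obtain ⟨H₁, hH₁⟩ := hd₁.isExactOn_univ
  obtain ⟨H₂, hH₂⟩ := hd₂.isExactOn_univ
  replace hH₁ : ∀ w, HasDerivAt H₁ (h₁ w) w := fun w => hH₁ w (Set.mem_univ w)
  replace hH₂ : ∀ w, HasDerivAt H₂ (h₂ w) w := fun w => hH₂ w (Set.mem_univ w)
  have hDH₂ : Differentiable ℂ H₂ := fun w => (hH₂ w).differentiableAt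
  set B : ℂ → ℂ := fun w => H₂ (w + 1) - H₂ w with hB
  have hDB : Differentiable ℂ B := by fun_prop
  obtain ⟨P, hP⟩ := hDB.isExactOn_univ
  replace hP : ∀ w, HasDerivAt P (B w) w := fun w => hP w (Set.mem_univ w)
  -- The Legendre relation integrated once; the linear term `2πi w` is the source of the quadratic
  -- term `π (Re w)²`.
  obtain ⟨C, hC⟩ : ∃ C : ℂ, ∀ w, H₁ (w + I) - H₁ w = B w + 2 * Real.pi * I * w + C := by
    have hder : ∀ w, HasDerivAt (fun w => H₁ (w + I) - H₁ w - B w - 2 * Real.pi * I * w) 0 w := by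
      intro w
      have a1 := (hH₁ (w + I)).comp_add_const w I
      have a2 := (hH₂ (w + 1)).comp_add_const w 1
      have a3 := (hasDerivAt_id w).const_mul (2 * Real.pi * I)
      have := ((a1.sub (hH₁ w)).sub (a2.sub (hH₂ w))).sub a3
      have hl := hg.legendre hd₁ hd₂ he₁ he₂ w
      rw [hl, mul_one, sub_self] at this
      exact this
    refine ⟨H₁ (0 + I) - H₁ 0 - B 0, fun w => ?_⟩
    have := is_const_of_deriv_eq_zero (fun w => (hder w).differentiableAt)
      (fun w => (hder w).deriv) w 0
    simp only [mul_zero, sub_zero] at this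
    linear_combination this
  have hV := locallyIntegrable_comp_equivRealProd_symm hg.locallyIntegrable
  -- The coordinates are exchanged so that `integral_unit_strip_add` also handles vertical shifts.
  have hV' : LocallyIntegrable fun p : ℝ × ℝ => Real.log ‖g (p.2 + p.1 * I)‖ := by
    have : Measure.map (Homeomorph.prodComm ℝ ℝ) volume = (volume : Measure (ℝ × ℝ)) :=
      Measure.prod_swap
    have h := (locallyIntegrable_map_homeomorph (Homeomorph.prodComm ℝ ℝ)
      (μ := (volume : Measure (ℝ × ℝ)))).1 (this.symm ▸ hV)
    exact h
  have hD₁ : ∀ᵐ p : ℝ × ℝ, Real.log ‖g ((p.1 + 1 : ℝ) + p.2 * I)‖ -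
      Real.log ‖g (p.1 + p.2 * I)‖ = (h₁ (p.1 + p.2 * I)).re := by
    filter_upwards [ae_comp_equivRealProd_symm hg.ae_ne_zero] with p hp
    rw [← log_norm_exp_mul he₁ hp]
    push_cast
    rw [add_right_comm]
  have hD₂ : ∀ᵐ p : ℝ × ℝ, Real.log ‖g (p.2 + (p.1 + 1 : ℝ) * I)‖ -
      Real.log ‖g (p.2 + p.1 * I)‖ = (h₂ (p.2 + p.1 * I)).re := by
    have := (Measure.measurePreserving_swap (μ := (volume : Measure ℝ))
      (ν := (volume : Measure ℝ))).quasiMeasurePreserving.ae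
        (ae_comp_equivRealProd_symm hg.ae_ne_zero)
    filter_upwards [this] with p hp
    simp only [Prod.fst_swap, Prod.snd_swap] at hp
    rw [← log_norm_exp_mul he₂ hp]
    push_cast
    rw [add_mul, one_mul, add_assoc]
  set M := cellIntegral (fun s => Real.log ‖g s‖) with hM
  -- The increments of `M` are integrals of `Im B + 2πx + Im C` in `x` and of `Re B` in `y`. As `P'
  -- = B`, `Im P` has partial derivatives `Im B` and `Re B`, so `N` should be constant in both
  -- variables.
  set N : ℝ → ℝ → ℝ := fun a b =>
    M (a + b * I) - (P (a + b * I)).im - Real.pi * a ^ 2 - a * C.im with hN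
  have hMab : ∀ a b : ℝ, M (a + b * I) = ∫ x in a..(a + 1), ∫ y in b..(b + 1),
      Real.log ‖g (x + y * I)‖ := fun a b => by simp [hM, cellIntegral]
  have inner₁ : ∀ x b : ℝ, ∫ y in b..(b + 1), (h₁ (x + y * I)).re =
      (B (x + b * I)).im + 2 * Real.pi * x + C.im := by
    intro x b
    have hder : ∀ y : ℝ, HasDerivAt (fun y : ℝ => (H₁ (x + y * I)).im) (h₁ (x + y * I)).re y :=
      fun y => by simpa using hasDerivAt_im (hasDerivAt_comp_vertical (hH₁ (x + y * I)))
    rw [intervalIntegral.integral_eq_sub_of_hasDerivAt (fun y _ => hder y)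
      ((continuous_re.comp (hd₁.continuous.comp (by fun_prop))).intervalIntegrable _ _)]
    have := congrArg Complex.im (hC (x + b * I))
    rw [sub_im, show (x : ℂ) + b * I + I = x + (b + 1 : ℝ) * I by push_cast; ring] at this
    rw [this]
    simp
  have inner₂ : ∀ y a : ℝ, ∫ x in a..(a + 1), (h₂ (x + y * I)).re = (B (a + y * I)).re := by
    intro y a
    have hder : ∀ x : ℝ, HasDerivAt (fun x : ℝ => (H₂ (x + y * I)).re) (h₂ (x + y * I)).re x :=
      fun x => hasDerivAt_re (hasDerivAt_comp_horizontal (hH₂ (x + y * I)))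
    rw [intervalIntegral.integral_eq_sub_of_hasDerivAt (fun y _ => hder y)
      ((continuous_re.comp (hd₂.continuous.comp (by fun_prop))).intervalIntegrable _ _), hB, sub_re,
      show (a : ℂ) + y * I + 1 = (a + 1 : ℝ) + y * I by push_cast; ring]
  have stepx : ∀ a δ b : ℝ, N (a + δ) b = N a b := by
    intro a δ b
    have h := integral_unit_strip_add hV hD₁ (a := a) (δ := δ) (c := b) (d := b + 1) (by linarith)
    simp only [inner₁] at h
    have hder : ∀ x : ℝ, HasDerivAt
        (fun x : ℝ => (P (x + b * I)).im + Real.pi * x ^ 2 + x * C.im)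
        ((B (x + b * I)).im + 2 * Real.pi * x + C.im) x := by
      intro x
      have a1 := hasDerivAt_im (hasDerivAt_comp_horizontal (hP (x + b * I)))
      have a2 := (hasDerivAt_pow 2 x).const_mul Real.pi
      have a3 := (hasDerivAt_id x).mul_const C.im
      convert! (a1.add a2).add a3 using 1
      simp
      ring
    rw [intervalIntegral.integral_eq_sub_of_hasDerivAt (fun x _ => hder x)
      (Continuous.intervalIntegrable
      (((continuous_im.comp (hDB.continuous.comp (by fun_prop))).add (by fun_prop)).add
        continuous_const) _ _)] at h
    simp only [hN, hMab]
    rw [h]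
    ring
  have stepy : ∀ a b δ : ℝ, N a (b + δ) = N a b := by
    intro a b δ
    have h := integral_unit_strip_add hV' hD₂ (a := b) (δ := δ) (c := a) (d := a + 1) (by linarith)
    simp only [inner₂] at h
    rw [← intervalIntegral_swap_of_locallyIntegrable hV (by linarith) (by linarith),
      ← intervalIntegral_swap_of_locallyIntegrable hV (by linarith) (by linarith)] at h
    have hder : ∀ y : ℝ, HasDerivAt (fun y : ℝ => (P (a + y * I)).im) (B (a + y * I)).re y :=
      fun y => by simpa using hasDerivAt_im (hasDerivAt_comp_vertical (hP (a + y * I)))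
    rw [intervalIntegral.integral_eq_sub_of_hasDerivAt (fun x _ => hder x)
      ((continuous_re.comp (hDB.continuous.comp (by fun_prop))).intervalIntegrable _ _)] at h
    simp only [hN, hMab]
    rw [h]
    ring
  -- `Re (-iP) = Im P`, and the real constant `Im C` times `w` has real part `Im C · Re w`.
  refine ⟨fun w => -I * P w + C.im * w + N 0 0, ?_, fun w => ?_⟩
  · have : Differentiable ℂ P := fun w => (hP w).differentiableAt
    fun_prop
  · have h1 := stepx 0 w.re w.im
    have h2 := stepy 0 0 w.im
    rw [zero_add] at h1 h2
    rw [h2] at h1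
    simp only [hN, re_add_im] at h1
    simp only [hN, add_re, mul_re, neg_re, neg_im, I_re, I_im, ofReal_re, ofReal_im]
    linarith

/-! ### Doubly periodic functions: almost periodicity and mean values -/

/-- Functions on `ℂ` with periods `1` and `i`. -/
def IsLatticePeriodic {F : Type*} (G : ℂ → F) : Prop :=
  (∀ w, G (w + 1) = G w) ∧ ∀ w, G (w + Complex.I) = G w

/-- The representative of `w` modulo `ℤ + iℤ` in the unit square. -/
noncomputable def latticeFract (w : ℂ) : ℂ := Int.fract w.re + Int.fract w.im * Complex.I

/-- The closed unit square. -/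
def closedCell : Set ℂ := Set.Icc 0 1 ×ℂ Set.Icc 0 1

theorem isCompact_closedCell : IsCompact closedCell := isCompact_Icc.reProdIm isCompact_Icc

theorem latticeFract_mem (w : ℂ) : latticeFract w ∈ closedCell := by
  constructor <;> simp [latticeFract, Int.fract_nonneg, (Int.fract_lt_one _).le]

namespace IsLatticePeriodic

open Complex

variable {F : Type*} {G : ℂ → F}

theorem add_int (hG : IsLatticePeriodic G) (w : ℂ) (p q : ℤ) : G (w + p + q * I) = G w := by
  have h1 : Function.Periodic G 1 := hG.1
  have h2 : Function.Periodic G I := hG.2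
  have e1 := h1.int_mul p w
  have e2 := h2.int_mul q (w + p)
  rw [mul_one] at e1
  rw [e2, e1]

theorem map_add_latticeFract (hG : IsLatticePeriodic G) (a w : ℂ) :
    G (a + latticeFract w) = G (a + w) := by
  rw [← hG.add_int (a + latticeFract w) ⌊w.re⌋ ⌊w.im⌋]
  congr 1
  conv_rhs => rw [← re_add_im w]
  simp only [latticeFract, Int.fract]
  push_cast
  ring

theorem map_latticeFract (hG : IsLatticePeriodic G) (w : ℂ) : G (latticeFract w) = G w := by
  simpa using hG.map_add_latticeFract 0 w

theorem exists_norm_le [SeminormedAddCommGroup F] (hG : IsLatticePeriodic G) (hc : Continuous G) :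
    ∃ B, ∀ w, ‖G w‖ ≤ B := by
  obtain ⟨B, hB⟩ := isCompact_closedCell.exists_bound_of_continuousOn hc.continuousOn
  exact ⟨B, fun w => hG.map_latticeFract w ▸ hB _ (latticeFract_mem w)⟩

/-- Only one of the two points is moved into the closed square; continuity is uniform there against
all nearby points of the plane, so crossing the edge of the cell causes no trouble. -/
theorem uniformContinuous [PseudoMetricSpace F] (hG : IsLatticePeriodic G) (hc : Continuous G) :
    UniformContinuous G := by
  refine Metric.uniformContinuous_iff.2 fun ε hε => ?_
  have h := isCompact_closedCell.uniformContinuousAt_of_continuousAt G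
    (fun _ _ => hc.continuousAt) (Metric.dist_mem_uniformity hε)
  obtain ⟨δ, hδ, hd⟩ := Metric.mem_uniformity_dist.1 h
  refine ⟨δ, hδ, fun a b hab => ?_⟩
  have hb : G (latticeFract a + (b - a)) = G b := by
    rw [add_comm, hG.map_add_latticeFract, sub_add_cancel]
  have := hd (a := latticeFract a) (b := latticeFract a + (b - a))
    (by rwa [dist_self_add_right, ← dist_eq_norm, dist_comm]) (latticeFract_mem a)
  simpa only [hb, hG.map_latticeFract a] using! this

/-- Shifts matter only modulo the lattice, so their values under `ℓ` have representatives in a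
compact square. Uniform continuity turns a convergent subsequence of these into uniform convergence
of the shifted functions. -/
theorem isAlmostPeriodic {m : ℕ} {G : ℂ → ℂ} (hG : IsLatticePeriodic G) (hc : Continuous G)
    (ℓ : (Fin m → ℝ) →L[ℝ] ℂ) : IsAlmostPeriodic fun t => G (ℓ t) := by
  refine ⟨hc.comp ℓ.continuous, fun h => ?_⟩
  obtain ⟨w, -, s, hs, hw⟩ := isCompact_closedCell.tendsto_subseq
    (x := fun n => latticeFract (ℓ (h n))) fun n => latticeFract_mem _
  refine ⟨s, hs, fun t => G (ℓ t + w), ?_⟩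
  refine Metric.tendstoUniformly_iff.2 fun ε hε => ?_
  obtain ⟨δ, hδ, hd⟩ := Metric.uniformContinuous_iff.1 (hG.uniformContinuous hc) ε hε
  filter_upwards [(Metric.tendsto_nhds.1 hw) δ hδ] with n hn t
  rw [map_add, ← hG.map_add_latticeFract _ (ℓ (h (s n)))]
  refine hd ?_
  rw [dist_add_left, dist_comm]
  exact hn

theorem cellIntegral_eq {G : ℂ → ℝ} (hG : IsLatticePeriodic G) (w : ℂ) :
    cellIntegral G w = cellIntegral G 0 := by
  have hy : ∀ x : ℝ, Function.Periodic (fun y : ℝ => G (x + y * I)) 1 := fun x y => by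
    have := hG.2 (x + y * I)
    simp only
    push_cast
    rw [← this]
    ring_nf
  have h1 : ∀ x : ℝ, ∫ y in w.im..(w.im + 1), G (x + y * I) =
      ∫ y in (0 : ℝ)..(0 + 1), G (x + y * I) :=
    fun x => (hy x).intervalIntegral_add_eq _ _
  have hx : Function.Periodic (fun x : ℝ => ∫ y in (0 : ℝ)..(0 + 1), G (x + y * I)) 1 := fun x => by
    refine intervalIntegral.integral_congr fun y _ => ?_
    have := hG.1 (x + y * I)
    push_cast
    rw [← this]
    ring_nf
  simp only [cellIntegral, h1]
  exact hx.intervalIntegral_add_eq _ _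

end IsLatticePeriodic

theorem cellIntegral_zero_eq {V : ℂ → ℝ}
    (hV : IntegrableOn (fun p : ℝ × ℝ => V (p.1 + p.2 * Complex.I))
      (Set.Ioc 0 1 ×ˢ Set.Ioc 0 1)) :
    cellIntegral V 0 =
      ∫ p in Set.Ioc (0 : ℝ) 1 ×ˢ Set.Ioc (0 : ℝ) 1, V (p.1 + p.2 * Complex.I) := by
  rw [Measure.volume_eq_prod, setIntegral_prod _ hV]
  simp [cellIntegral, intervalIntegral.integral_of_le]

theorem abs_setIntegral_sub_le {X : Type*} [MeasurableSpace X] {μ : Measure X} {f : X → ℝ} {B : ℝ}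
    (hB : ∀ x, ‖f x‖ ≤ B) (hf : AEStronglyMeasurable f μ) {s t : Set X} (hst : s ⊆ t)
    (hs : MeasurableSet s) (ht : μ t ≠ ⊤) :
    |∫ x in t, f x ∂μ - ∫ x in s, f x ∂μ| ≤ B * (μ.real t - μ.real s) := by
  have hi : IntegrableOn f t μ := Measure.integrableOn_of_bounded ht hf (ae_of_all _ hB)
  rw [← setIntegral_sdiff hs hi hst, ← measureReal_sdiff hst hs ht]
  exact norm_setIntegral_le_of_norm_le_const
    ((measure_mono Set.sdiff_subset).trans_lt ht.lt_top) fun x _ => hB x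

theorem volume_real_ball {m : ℕ} (a : Fin m → ℝ) {r : ℝ} (hr : 0 < r) :
    (volume : Measure (Fin m → ℝ)).real (Metric.ball a r) = (2 * r) ^ m := by
  rw [measureReal_def, Real.volume_pi_ball a hr, ENNReal.toReal_ofReal (by positivity),
    Fintype.card_fin]

/-- Both the ball and its translate lie in the concentric ball of radius `N + r`, so each integral
is compared with the one over that larger ball. -/
theorem abs_setIntegral_ball_add_sub_le {m : ℕ} {f : (Fin m → ℝ) → ℝ} {B : ℝ}
    (hB : ∀ x, ‖f x‖ ≤ B) (hf : Continuous f) {s : Fin m → ℝ} {r N : ℝ} (hs : ‖s‖ ≤ r)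
    (hN : 0 < N) :
    |(∫ t in Metric.ball 0 N, f (t + s)) - ∫ t in Metric.ball 0 N, f t| ≤
      2 * (B * ((2 * (N + r)) ^ m - (2 * N) ^ m)) := by
  have hr : 0 ≤ r := (norm_nonneg s).trans hs
  have h1 : ∫ t in Metric.ball 0 N, f (t + s) = ∫ t in Metric.ball s N, f t := by
    rw [← (measurePreserving_add_right volume s).setIntegral_preimage_emb
      (MeasurableEquiv.addRight s).measurableEmbedding f (Metric.ball s N)]
    congr 2
    ext t
    simp [dist_eq_norm]
  have a1 := abs_setIntegral_sub_le hB (μ := volume) hf.aestronglyMeasurable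
    (Metric.ball_subset_ball (by linarith) : Metric.ball (0 : Fin m → ℝ) N ⊆ Metric.ball 0 (N + r))
    measurableSet_ball (by simp [Real.volume_pi_ball 0 (show 0 < N + r by linarith)])
  have a2 := abs_setIntegral_sub_le hB (μ := volume) hf.aestronglyMeasurable
    (Metric.ball_subset_ball' (by rw [dist_zero_right]; linarith) :
      Metric.ball s N ⊆ Metric.ball 0 (N + r))
    measurableSet_ball (by simp [Real.volume_pi_ball 0 (show 0 < N + r by linarith)])
  rw [volume_real_ball _ hN, volume_real_ball _ (by linarith)] at a1 a2
  rw [h1, abs_le]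
  rw [abs_le] at a1 a2
  constructor <;> linarith [a1.1, a1.2, a2.1, a2.2]

theorem setOf_forall_abs_lt {m : ℕ} {N : ℝ} (hN : 0 < N) :
    {t : Fin m → ℝ | ∀ j, |t j| < N} = Metric.ball 0 N := by
  ext t
  simp [pi_norm_lt_iff hN]

open Complex in
/-- The mean value of a doubly periodic function along a linear surjection `ℝᵐ → ℂ`. -/
theorem IsLatticePeriodic.tendsto_mean {m : ℕ} {G : ℂ → ℝ} (hG : IsLatticePeriodic G)
    (hc : Continuous G) (ℓ : (Fin m → ℝ) →L[ℝ] ℂ) (hℓ : Function.Surjective ℓ) :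
    Tendsto (fun N : ℝ => ((2 * N) ^ m)⁻¹ *
        ∫ t in {t : Fin m → ℝ | ∀ j, |t j| < N}, G (ℓ t)) atTop (𝓝 (cellIntegral G 0)) := by
  obtain ⟨B, hB⟩ := hG.exists_norm_le hc
  obtain ⟨σ, hσ⟩ := (ℓ : (Fin m → ℝ) →ₗ[ℝ] ℂ).exists_rightInverse_of_surjective
    (LinearMap.range_eq_top.2 hℓ)
  -- A linear section of `ℓ`: moving the argument of `G` by a point of the cell amounts to moving
  -- `t` by a vector of norm at most `r`, negligible against `N`.
  set S : ℂ →L[ℝ] (Fin m → ℝ) := LinearMap.toContinuousLinearMap σ with hS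
  have hS' : ∀ w, ℓ (S w) = w := fun w => LinearMap.congr_fun hσ w
  set r := ‖S‖ * 2
  have hcell : ∀ p : ℝ × ℝ, p ∈ Set.Ioc (0 : ℝ) 1 ×ˢ Set.Ioc (0 : ℝ) 1 →
      ‖S (p.1 + p.2 * I)‖ ≤ r := by
    intro p hp
    refine (S.le_opNorm _).trans (mul_le_mul_of_nonneg_left ?_ (norm_nonneg _))
    refine (norm_add_le _ _).trans ?_
    have h1 := abs_le.2 ⟨by linarith [hp.1.1], hp.1.2⟩
    have h2 := abs_le.2 ⟨by linarith [hp.2.1], hp.2.2⟩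
    simp only [norm_mul, norm_I, mul_one, norm_real, Real.norm_eq_abs]
    linarith
  have hvol : (volume : Measure (ℝ × ℝ)).real (Set.Ioc (0 : ℝ) 1 ×ˢ Set.Ioc (0 : ℝ) 1) = 1 := by
    simp [measureReal_def, Measure.volume_eq_prod]
  have hvol' : (volume : Measure (ℝ × ℝ)) (Set.Ioc (0 : ℝ) 1 ×ˢ Set.Ioc (0 : ℝ) 1) < ⊤ := by
    simp [Measure.volume_eq_prod]
  have key : ∀ N : ℝ, 0 < N → |((2 * N) ^ m)⁻¹ * (∫ t in Metric.ball 0 N, G (ℓ t)) -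
      cellIntegral G 0| ≤ 2 * (B * ((1 + r / N) ^ m - 1)) := by
    intro N hN
    have hfin : (volume : Measure (Fin m → ℝ)) (Metric.ball 0 N) < ⊤ := by
      simp [Real.volume_pi_ball 0 hN]
    set Φ : ℝ × ℝ → ℝ := fun p => ∫ t in Metric.ball (0 : Fin m → ℝ) N, G (ℓ t + (p.1 + p.2 * I))
      with hΦ
    have hint : Integrable (Function.uncurry fun (p : ℝ × ℝ) (t : Fin m → ℝ) =>
        G (ℓ t + (p.1 + p.2 * I))) ((volume.restrict (Set.Ioc (0 : ℝ) 1 ×ˢ Set.Ioc (0 : ℝ) 1)).prod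
          (volume.restrict (Metric.ball 0 N))) := by
      rw [Measure.prod_restrict]
      refine Measure.integrableOn_of_bounded (M := B) ?_ ?_ (ae_of_all _ fun _ => hB _)
      · rw [Measure.prod_prod]
        exact ENNReal.mul_ne_top hvol'.ne hfin.ne
      · refine Continuous.aestronglyMeasurable ?_
        exact hc.comp (by fun_prop)
    have hcellG : ∀ w, cellIntegral G 0 =
        ∫ p in Set.Ioc (0 : ℝ) 1 ×ˢ Set.Ioc (0 : ℝ) 1, G (w + (p.1 + p.2 * I)) := by
      intro w
      rw [← hG.cellIntegral_eq w, ← cellIntegral_comp_add, cellIntegral_zero_eq]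
      refine Measure.integrableOn_of_bounded (M := B) hvol'.ne ?_ (ae_of_all _ fun _ => hB _)
      refine Continuous.aestronglyMeasurable ?_
      exact hc.comp (by fun_prop)
    -- Averaging first over the cell is exact: by periodicity each `t` contributes the same cell
    -- integral.
    have hswap : ∫ p in Set.Ioc (0 : ℝ) 1 ×ˢ Set.Ioc (0 : ℝ) 1, Φ p =
        (2 * N) ^ m * cellIntegral G 0 := by
      rw [hΦ, integral_integral_swap hint]
      simp_rw [← hcellG]
      rw [setIntegral_const, volume_real_ball _ hN, smul_eq_mul]
    have hΦi : IntegrableOn Φ (Set.Ioc (0 : ℝ) 1 ×ˢ Set.Ioc (0 : ℝ) 1) := hint.integral_prod_left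
    have hbound : ∀ p ∈ Set.Ioc (0 : ℝ) 1 ×ˢ Set.Ioc (0 : ℝ) 1,
        ‖(∫ t in Metric.ball 0 N, G (ℓ t)) - Φ p‖ ≤
          2 * (B * ((2 * (N + r)) ^ m - (2 * N) ^ m)) := by
      intro p hp
      have := abs_setIntegral_ball_add_sub_le (f := fun t => G (ℓ t)) (fun t => hB _)
        (hc.comp ℓ.continuous) (hcell p hp) hN
      simp only [map_add, hS'] at this
      rwa [Real.norm_eq_abs, abs_sub_comm]
    have h1 := norm_setIntegral_le_of_norm_le_const hvol' hbound
    have hconst : IntegrableOn (fun _ : ℝ × ℝ => ∫ t in Metric.ball 0 N, G (ℓ t))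
        (Set.Ioc (0 : ℝ) 1 ×ˢ Set.Ioc (0 : ℝ) 1) := integrableOn_const hvol'.ne
    rw [integral_sub hconst hΦi, hswap, setIntegral_const, hvol, one_smul, mul_one] at h1
    have hp : 0 < (2 * N) ^ m := by positivity
    have e1 : ((2 * N) ^ m)⁻¹ * (∫ t in Metric.ball 0 N, G (ℓ t)) - cellIntegral G 0 =
        ((2 * N) ^ m)⁻¹ * ((∫ t in Metric.ball 0 N, G (ℓ t)) - (2 * N) ^ m * cellIntegral G 0) := by
      field_simp
    rw [e1, abs_mul, abs_of_pos (inv_pos.2 hp), inv_mul_le_iff₀ hp]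
    refine h1.trans_eq ?_
    have e2 : (2 * (N + r)) ^ m = (2 * N) ^ m * (1 + r / N) ^ m := by
      rw [← mul_pow]; congr 1; field_simp
    rw [e2]
    ring
  have hlim : Tendsto (fun N : ℝ => 2 * (B * ((1 + r / N) ^ m - 1))) atTop (𝓝 0) := by
    have h0 : Tendsto (fun N : ℝ => r / N) atTop (𝓝 0) := tendsto_const_nhds.div_atTop tendsto_id
    have := (((h0.const_add 1).pow m).sub_const 1).const_mul B |>.const_mul 2
    simpa using this
  rw [tendsto_iff_norm_sub_tendsto_zero]
  refine squeeze_zero' (Eventually.of_forall fun _ => norm_nonneg _) ?_ hlim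
  filter_upwards [eventually_gt_atTop 0] with N hN
  rw [setOf_forall_abs_lt hN]
  exact key N hN

/-! ### Pairing a pullback with a test function, as a function of the shift -/

/-- The integral of `V (L z + w) ψ z` over `ℂᵐ`. -/
noncomputable def pullbackPairing {m : ℕ} (V : ℂ → ℝ) (L : (Fin m → ℂ) →L[ℂ] ℂ)
    (ψ : (Fin m → ℂ) → ℝ) (w : ℂ) : ℝ := ∫ z, V (L z + w) * ψ z

section

variable {m : ℕ} {V : ℂ → ℝ} {L : (Fin m → ℂ) →L[ℂ] ℂ} {ψ : (Fin m → ℂ) → ℝ}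

theorem exists_map_eq_one (hL : L ≠ 0) : ∃ e, L e = 1 := by
  obtain ⟨k, hk⟩ := exists_single_ne_zero hL
  exact ⟨(L (Pi.single k 1))⁻¹ • Pi.single k 1, by
    rw [map_smul, smul_eq_mul, inv_mul_cancel₀ hk]⟩

theorem locallyIntegrable_comp_add_const (hV : LocallyIntegrable V) (w : ℂ) :
    LocallyIntegrable fun s => V (s + w) := by
  refine (locallyIntegrable_map_homeomorph (Homeomorph.addRight w) (μ := volume) (f := V)).1 ?_
  change LocallyIntegrable _ (Measure.map (fun x => x + w) volume)
  rwa [map_add_right_eq_self]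

theorem integrable_pullback_mul (hV : LocallyIntegrable V) (hL : L ≠ 0) (hψ : Continuous ψ)
    (hc : HasCompactSupport ψ) (w : ℂ) : Integrable fun z => V (L z + w) * ψ z := by
  have := (locallyIntegrable_comp_linear (locallyIntegrable_comp_add_const hV w)
    hL).integrable_smul_left_of_hasCompactSupport hψ hc
  simpa only [smul_eq_mul, mul_comm] using this

theorem integral_pullback_mul_translate (V : ℂ → ℝ) (L : (Fin m → ℂ) →L[ℂ] ℂ)
    (ψ : (Fin m → ℂ) → ℝ) (w : ℂ) (s : Fin m → ℂ) :
    ∫ z, V (L z + w) * ψ (z - s) = pullbackPairing V L ψ (L s + w) := by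
  rw [pullbackPairing, ← integral_add_right_eq_self (μ := volume) _ s]
  simp only [map_add, add_sub_cancel_right, add_assoc]

/-- With `L e = 1`, the value at `w` is the convolution of `V ∘ L` with the reflected `ψ` at the
point `w • e`; convolution with a continuous compactly supported function is continuous. -/
theorem continuous_pullbackPairing (hV : LocallyIntegrable V) (hL : L ≠ 0) (hψ : Continuous ψ)
    (hc : HasCompactSupport ψ) : Continuous (pullbackPairing V L ψ) := by
  obtain ⟨e, he⟩ := exists_map_eq_one hL
  have h := (hc.comp_homeomorph (Homeomorph.neg (Fin m → ℂ))).continuous_convolution_right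
    (ContinuousLinearMap.mul ℝ ℝ) (locallyIntegrable_comp_linear hV hL)
    (hψ.comp (Homeomorph.neg (Fin m → ℂ)).continuous)
  have h2 := h.comp (f := fun w : ℂ => w • e) (by fun_prop)
  refine h2.congr fun w => ?_
  have h3 := integral_pullback_mul_translate V L ψ 0 (w • e)
  rw [map_smul, he, smul_eq_mul, mul_one, add_zero] at h3
  rw [← h3]
  simp only [Function.comp, convolution, add_zero, ContinuousLinearMap.mul_apply',
    Homeomorph.coe_neg, neg_sub]

theorem cellIntegral_pullbackPairing (hV : LocallyIntegrable V) (hm : Measurable V) (hL : L ≠ 0)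
    (hψ : Continuous ψ) (hc : HasCompactSupport ψ) :
    cellIntegral (pullbackPairing V L ψ) 0 = ∫ z, cellIntegral V (L z) * ψ z := by
  have hfin : (volume : Measure (ℝ × ℝ)) (Set.Ioc (0 : ℝ) 1 ×ˢ Set.Ioc (0 : ℝ) 1) ≠ ⊤ := by
    simp [Measure.volume_eq_prod]
  have hcont : ∀ {W : ℂ → ℝ} {χ : (Fin m → ℂ) → ℝ}, LocallyIntegrable W → Continuous χ →
      HasCompactSupport χ → IntegrableOn (fun p : ℝ × ℝ =>
        pullbackPairing W L χ (p.1 + p.2 * Complex.I)) (Set.Ioc (0 : ℝ) 1 ×ˢ Set.Ioc (0 : ℝ) 1) := by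
    intro W χ hW hχ hχc
    have h : Continuous fun p : ℝ × ℝ => pullbackPairing W L χ (p.1 + p.2 * Complex.I) :=
      (continuous_pullbackPairing hW hL hχ hχc).comp (by fun_prop)
    exact (h.continuousOn.integrableOn_compact (isCompact_Icc.prod isCompact_Icc)).mono_set
      (Set.prod_mono Set.Ioc_subset_Icc_self Set.Ioc_subset_Icc_self)
  have hmeas : AEStronglyMeasurable (Function.uncurry fun (p : ℝ × ℝ) (z : Fin m → ℂ) =>
      V (L z + (p.1 + p.2 * Complex.I)) * ψ z)
      ((volume.restrict (Set.Ioc (0 : ℝ) 1 ×ˢ Set.Ioc (0 : ℝ) 1)).prod volume) := by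
    refine Measurable.aestronglyMeasurable (Measurable.mul ?_ ?_)
    · refine hm.comp (Continuous.measurable ?_)
      fun_prop
    · exact (hψ.comp continuous_snd).measurable
  have hint : Integrable (Function.uncurry fun (p : ℝ × ℝ) (z : Fin m → ℂ) =>
      V (L z + (p.1 + p.2 * Complex.I)) * ψ z)
      ((volume.restrict (Set.Ioc (0 : ℝ) 1 ×ˢ Set.Ioc (0 : ℝ) 1)).prod volume) := by
    refine (integrable_prod_iff hmeas).2
      ⟨ae_of_all _ fun p => integrable_pullback_mul hV hL hψ hc (p.1 + p.2 * Complex.I), ?_⟩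
    -- Absolute integrability on the product is the same continuity statement, applied to `|V|` and
    -- `|ψ|`.
    have := hcont (W := fun s => ‖V s‖) (χ := fun z => ‖ψ z‖) (fun x => (hV x).norm) hψ.norm hc.norm
    simpa only [pullbackPairing, Function.uncurry, norm_mul] using! this
  rw [cellIntegral_zero_eq (hcont hV hψ hc)]
  simp only [pullbackPairing]
  rw [integral_integral_swap hint]
  refine integral_congr_ae (ae_of_all _ fun z => ?_)
  simp only
  rw [integral_mul_const, ← cellIntegral_comp_add, cellIntegral_zero_eq]
  have h1 := locallyIntegrable_comp_equivRealProd_symm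
    (locallyIntegrable_comp_add_const hV (L z))
  have h2 := (h1.integrableOn_isCompact (isCompact_Icc.prod isCompact_Icc)).mono_set
      (Set.prod_mono (Set.Ioc_subset_Icc_self (a := (0 : ℝ)) (b := 1))
        (Set.Ioc_subset_Icc_self (a := (0 : ℝ)) (b := 1)))
  simpa only [add_comm] using h2

theorem ae_comp_linear {P : ℂ → Prop} (hP : ∀ᵐ w, P w) (hL : L ≠ 0) (w : ℂ) :
    ∀ᵐ z, P (L z + w) := by
  obtain ⟨s, hs, hsm, hs0⟩ := exists_measurable_superset_of_null (ae_iff.1 hP)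
  have h1 : ∀ᵐ a : ℂ, a ∈ sᶜ := measure_eq_zero_iff_ae_notMem.1 hs0
  have h2 : ∀ᵐ a : ℂ, a ∈ (fun a => a + w) ⁻¹' sᶜ :=
    (measurePreserving_add_right volume w).quasiMeasurePreserving.ae h1
  have hsurj : Function.Surjective (L.restrictScalars ℝ : (Fin m → ℂ) →ₗ[ℝ] ℂ) := fun a => by
    obtain ⟨e, he⟩ := exists_map_eq_one hL
    refine ⟨a • e, ?_⟩
    change L (a • e) = a
    rw [map_smul, he, smul_eq_mul, mul_one]
  have h3 := (ae_comp_linearMap_mem_iff (𝕜 := ℝ)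
    (L.restrictScalars ℝ : (Fin m → ℂ) →ₗ[ℝ] ℂ) volume volume hsurj
    ((measurable_add_const w) hsm.compl)).2 h2
  filter_upwards [h3] with z hz
  by_contra h
  exact hz (hs h)

end

/-! ### Integration by parts against test functions -/

section IBP

variable {E : Type*} [NormedAddCommGroup E] [NormedSpace ℝ E] {Ω : Opens E}

theorem hasLineDerivAt_testFunction (φ : 𝓓(Ω, ℝ)) (z v : E) :
    HasLineDerivAt ℝ φ ((∂_{v} φ) z) z v := by
  have h : DifferentiableAt ℝ φ z := (φ.contDiff.differentiable (by simp)).differentiableAt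
  have := h.lineDifferentiableAt (v := v) |>.hasLineDerivAt
  have e : (∂_{v} φ) z = lineDeriv ℝ φ z v := by
    rw [TestFunction.lineDerivOp_eq_lineDerivCLM ℝ, TestFunction.lineDerivCLM_apply_of_le (by simp)]
  rwa [e]

theorem lineDerivOp_testFunction_apply (φ : 𝓓(Ω, ℝ)) (v z : E) :
    (∂_{v} φ) z = fderiv ℝ φ z v := by
  have h : DifferentiableAt ℝ φ z := (φ.contDiff.differentiable (by simp)).differentiableAt
  rw [← (hasLineDerivAt_testFunction φ z v).lineDeriv, h.lineDeriv_eq_fderiv]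

theorem lineDerivOp_comm_testFunction (φ : 𝓓(Ω, ℝ)) (a b : E) :
    ∂_{a} (∂_{b} φ) = ∂_{b} (∂_{a} φ) := by
  ext z
  have hd : DifferentiableAt ℝ (fderiv ℝ φ) z :=
    ((φ.contDiff.fderiv_right (m := 1) (WithTop.coe_le_coe.2
      (le_top : (1 + 1 : ℕ∞) ≤ ⊤))).differentiable (by simp)).differentiableAt
  have h : ∀ a b : E, (∂_{a} (∂_{b} φ)) z = fderiv ℝ (fderiv ℝ φ) z a b := by
    intro a b
    rw [lineDerivOp_testFunction_apply]
    have : ⇑(∂_{b} φ : 𝓓(Ω, ℝ)) = fun z => fderiv ℝ φ z b :=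
      funext fun z => lineDerivOp_testFunction_apply φ b z
    rw [this, fderiv_clm_apply hd (differentiableAt_const b)]
    simp
  rw [h, h]
  exact (φ.contDiff.contDiffAt (x := z)).isSymmSndFDerivAt
    (by simpa using! WithTop.coe_le_coe.2 (le_top : (2 : ℕ∞) ≤ ⊤)) a b

variable [MeasurableSpace E] [BorelSpace E] {μ : Measure E}

theorem integrable_mul_testFunction {q : E → ℝ} (hq : LocallyIntegrable q μ) (φ : 𝓓(Ω, ℝ)) :
    Integrable (fun z => q z * φ z) μ := by
  have := hq.integrable_smul_left_of_hasCompactSupport φ.continuous φ.hasCompactSupport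
  simpa only [smul_eq_mul, mul_comm] using this

variable [FiniteDimensional ℝ E] [μ.IsAddHaarMeasure]

/-- Integration by parts against a test function. -/
theorem integral_mul_lineDerivOp {q q' : E → ℝ} {v : E} (hq : LocallyIntegrable q μ)
    (hq' : LocallyIntegrable q' μ) (hd : ∀ z, HasLineDerivAt ℝ q (q' z) z v) (φ : 𝓓(Ω, ℝ)) :
    ∫ z, q z * (∂_{v} φ) z ∂μ = -∫ z, q' z * φ z ∂μ := by
  exact integral_bilinear_hasLineDerivAt_right_eq_neg_left_of_integrable
    (B := ContinuousLinearMap.mul ℝ ℝ) (integrable_mul_testFunction hq' φ)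
    (integrable_mul_testFunction hq (∂_{v} φ)) (integrable_mul_testFunction hq φ)
    (fun z _ => hd z) fun z _ => hasLineDerivAt_testFunction φ z v

theorem integral_mul_lineDerivOp_lineDerivOp {q q₁ q₂ : E → ℝ} {a b : E} (hq : Continuous q)
    (hq₁ : Continuous q₁) (hq₂ : Continuous q₂) (hd : ∀ z, HasLineDerivAt ℝ q (q₁ z) z a)
    (hd₁ : ∀ z, HasLineDerivAt ℝ q₁ (q₂ z) z b) (φ : 𝓓(Ω, ℝ)) :
    ∫ z, q z * (∂_{a} (∂_{b} φ)) z ∂μ = ∫ z, q₂ z * φ z ∂μ := by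
  rw [integral_mul_lineDerivOp hq.locallyIntegrable hq₁.locallyIntegrable hd,
    integral_mul_lineDerivOp hq₁.locallyIntegrable hq₂.locallyIntegrable hd₁, neg_neg]

/-- A function invariant under translations along `v` annihilates derivatives along `v`. -/
theorem integral_mul_lineDerivOp_eq_zero {q : E → ℝ} {v : E} (hq : LocallyIntegrable q μ)
    (hv : ∀ z (t : ℝ), q (z + t • v) = q z) (φ : 𝓓(Ω, ℝ)) :
    ∫ z, q z * (∂_{v} φ) z ∂μ = 0 := by
  rw [integral_mul_lineDerivOp hq (q' := fun _ => 0) locallyIntegrable_zero fun z => ?_]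
  · simp
  · unfold HasLineDerivAt
    simp only [hv]
    exact hasDerivAt_const _ _

end IBP

/-! ### Coefficients of the current and the second-order operators behind them -/

section

variable {m : ℕ} {Ω : Opens (Fin m → ℝ)}

/-- `(∂²/∂x_k∂x_j + ∂²/∂y_k∂y_j) φ`. -/
noncomputable def reHessian (j k : Fin m) (φ : 𝓓(tube Ω, ℝ)) : 𝓓(tube Ω, ℝ) :=
  ∂_{(Pi.single k 1 : Fin m → ℂ)} (∂_{(Pi.single j 1 : Fin m → ℂ)} φ) +
    ∂_{(Pi.single k Complex.I : Fin m → ℂ)} (∂_{(Pi.single j Complex.I : Fin m → ℂ)} φ)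

/-- `(∂²/∂y_k∂x_j - ∂²/∂x_k∂y_j) φ`. -/
noncomputable def imHessian (j k : Fin m) (φ : 𝓓(tube Ω, ℝ)) : 𝓓(tube Ω, ℝ) :=
  ∂_{(Pi.single k Complex.I : Fin m → ℂ)} (∂_{(Pi.single j 1 : Fin m → ℂ)} φ) -
    ∂_{(Pi.single k 1 : Fin m → ℂ)} (∂_{(Pi.single j Complex.I : Fin m → ℂ)} φ)

/-- The signs of the two distributional derivatives cancel, and `2/π` times the two factors `1/2` is
`1/(2π)`. As `log|f|` is real, the two operators give the real and imaginary parts. -/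
theorem divisorCurrent_apply (f : (Fin m → ℂ) → ℂ) (j k : Fin m) (φ : 𝓓(tube Ω, ℝ)) :
    divisorCurrent Ω f j k φ = (1 / (2 * Real.pi) : ℂ) *
      ((ofFunction Ω (fun z => Real.log ‖f z‖) (reHessian j k φ) : ℝ) +
        Complex.I * (ofFunction Ω (fun z => Real.log ‖f z‖) (imHessian j k φ) : ℝ)) := by
  set T := ofFunction Ω fun z => Real.log ‖f z‖ with hT
  set F : 𝓓'(tube Ω, ℂ) := Distribution.mapCLM Complex.ofRealCLM T with hF
  have hFa : ∀ ψ, F ψ = (T ψ : ℝ) := fun ψ => rfl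
  have h1 : ∀ ψ, dzbar k F ψ = (1 / 2 : ℂ) * (F (-∂_{(Pi.single k 1 : Fin m → ℂ)} ψ) +
      Complex.I * F (-∂_{(Pi.single k Complex.I : Fin m → ℂ)} ψ)) := fun ψ => by
    rw [← Distribution.lineDerivOp_apply_apply, ← Distribution.lineDerivOp_apply_apply]
    rfl
  have h2 : ∀ (G : 𝓓'(tube Ω, ℂ)) ψ, dz j G ψ = (1 / 2 : ℂ) *
      (G (-∂_{(Pi.single j 1 : Fin m → ℂ)} ψ) -
      Complex.I * G (-∂_{(Pi.single j Complex.I : Fin m → ℂ)} ψ)) := fun G ψ => by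
    rw [← Distribution.lineDerivOp_apply_apply, ← Distribution.lineDerivOp_apply_apply]
    rfl
  have h3 : divisorCurrent Ω f j k φ = (2 / Real.pi : ℂ) * dz j (dzbar k F) φ := rfl
  rw [h3, h2, h1, h1]
  simp only [LineDeriv.lineDerivOp_neg, neg_neg, hFa, reHessian, imHessian, map_add, map_sub]
  have : (Real.pi : ℂ) ≠ 0 := by exact_mod_cast Real.pi_ne_zero
  push_cast
  field_simp
  linear_combination (-(T (∂_{(Pi.single k Complex.I : Fin m → ℂ)}
    (∂_{(Pi.single j Complex.I : Fin m → ℂ)} φ)) : ℂ)) * Complex.I_sq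

theorem lineDerivOp_translate (t : Fin m → ℝ) (v : Fin m → ℂ) (φ : 𝓓(tube Ω, ℝ)) :
    ∂_{v} (translate t φ) = translate t (∂_{v} φ) := by
  ext z
  change _ = (∂_{v} φ) (z - realVec t)
  rw [lineDerivOp_testFunction_apply, lineDerivOp_testFunction_apply]
  change fderiv ℝ (fun z => φ (z - realVec t)) z v = _
  rw [fderiv_comp_sub]

theorem reHessian_translate (t : Fin m → ℝ) (j k : Fin m) (φ : 𝓓(tube Ω, ℝ)) :
    reHessian j k (translate t φ) = translate t (reHessian j k φ) := by
  simp only [reHessian, lineDerivOp_translate]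
  rfl

theorem imHessian_translate (t : Fin m → ℝ) (j k : Fin m) (φ : 𝓓(tube Ω, ℝ)) :
    imHessian j k (translate t φ) = translate t (imHessian j k φ) := by
  simp only [imHessian, lineDerivOp_translate]
  rfl

theorem ofFunction_apply {v : (Fin m → ℂ) → ℝ} (hv : LocallyIntegrable v) (φ : 𝓓(tube Ω, ℝ)) :
    ofFunction Ω v φ = ∫ z, v z * φ z := by
  refine (TestFunction.integralAgainstBilinCLM_eq_integral (hv.locallyIntegrableOn _)).trans ?_
  simp only [ContinuousLinearMap.mul_apply', mul_comm]

variable (L : (Fin m → ℂ) →L[ℂ] ℂ)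

theorem hasLineDerivAt_re_comp_linear {K : ℂ → ℂ} (hK : Differentiable ℂ K) (w : ℂ)
    (z v : Fin m → ℂ) :
    HasLineDerivAt ℝ (fun z => (K (L z + w)).re) (deriv K (L z + w) * L v).re z v := by
  have h1 : HasDerivAt (fun t : ℝ => L (z + t • v) + w) (L v) 0 := by
    have : (fun t : ℝ => L (z + t • v) + w) = fun t : ℝ => (L z + w) + (t : ℂ) * L v := by
      funext t
      rw [map_add, ← Complex.coe_smul, map_smul, smul_eq_mul, add_right_comm]
    rw [this]
    simpa using (((hasDerivAt_id (0 : ℝ)).ofReal_comp).mul_const (L v)).const_add (L z + w)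
  have h2 : HasDerivAt K (deriv K (L z + w)) (L (z + (0 : ℝ) • v) + w) := by
    rw [zero_smul, add_zero]
    exact (hK _).hasDerivAt
  exact hasDerivAt_re (h2.comp (0 : ℝ) h1)

theorem integral_re_comp_linear_mul {E' : Opens (Fin m → ℂ)} {K : ℂ → ℂ} (hK : Differentiable ℂ K)
    (w : ℂ) (a b : Fin m → ℂ) (φ : 𝓓(E', ℝ)) :
    ∫ z, (K (L z + w)).re * (∂_{a} (∂_{b} φ)) z =
      ∫ z, (deriv (deriv K) (L z + w) * (L a * L b)).re * φ z := by
  have hd : ∀ {K : ℂ → ℂ}, Differentiable ℂ K → Differentiable ℂ (deriv K) := fun hK w =>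
    ((hK.differentiableOn (s := Set.univ)).deriv isOpen_univ).differentiableAt univ_mem
  have hK' := hd hK
  have hK'' := hd hK'
  refine integral_mul_lineDerivOp_lineDerivOp (q₁ := fun z => (deriv K (L z + w) * L a).re)
    ?_ ?_ ?_ (fun z => hasLineDerivAt_re_comp_linear L hK w z a) (fun z => ?_) φ
  · exact Complex.continuous_re.comp (hK.continuous.comp (by fun_prop))
  · exact Complex.continuous_re.comp ((hK'.continuous.comp (by fun_prop)).mul continuous_const)
  · exact Complex.continuous_re.comp ((hK''.continuous.comp (by fun_prop)).mul continuous_const)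
  · have := hasLineDerivAt_re_comp_linear L (hK'.mul_const (L a)) w z b
    rw [deriv_mul_const (hK' _), mul_assoc] at this
    exact this

theorem map_single_I (j : Fin m) : L (Pi.single j Complex.I) = Complex.I * L (Pi.single j 1) := by
  rw [← smul_eq_mul, ← map_smul, ← Pi.single_smul, smul_eq_mul, mul_one]

theorem integrable_re_comp_linear_mul {K : ℂ → ℂ} (hK : Differentiable ℂ K) (w : ℂ)
    (ψ : 𝓓(tube Ω, ℝ)) : Integrable fun z => (K (L z + w)).re * ψ z :=
  integrable_mul_testFunction (Continuous.locallyIntegrable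
    (Complex.continuous_re.comp (hK.continuous.comp (by fun_prop)))) ψ

/-- `K ∘ L` is holomorphic, so replacing both directions by their multiples by `i` changes the sign
of its second derivative. -/
theorem integral_re_mul_reHessian {K : ℂ → ℂ} (hK : Differentiable ℂ K) (w : ℂ) (j k : Fin m)
    (φ : 𝓓(tube Ω, ℝ)) : ∫ z, (K (L z + w)).re * reHessian j k φ z = 0 := by
  have e : ∀ z, reHessian j k φ z =
      (∂_{(Pi.single k 1 : Fin m → ℂ)} (∂_{(Pi.single j 1 : Fin m → ℂ)} φ)) z +
      (∂_{(Pi.single k Complex.I : Fin m → ℂ)} (∂_{(Pi.single j Complex.I : Fin m → ℂ)} φ)) z :=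
    fun z => rfl
  simp only [e, mul_add]
  rw [integral_add (integrable_re_comp_linear_mul L hK w _) (integrable_re_comp_linear_mul L hK w _),
    integral_re_comp_linear_mul L hK, integral_re_comp_linear_mul L hK, map_single_I, map_single_I,
    mul_mul_mul_comm, Complex.I_mul_I]
  simp only [mul_neg, Complex.neg_re, neg_mul, one_mul, integral_neg, add_neg_cancel]

/-- In both mixed derivatives exactly one direction carries the factor `i`, so complex linearity
makes them equal. -/
theorem integral_re_mul_imHessian {K : ℂ → ℂ} (hK : Differentiable ℂ K) (w : ℂ) (j k : Fin m)
    (φ : 𝓓(tube Ω, ℝ)) : ∫ z, (K (L z + w)).re * imHessian j k φ z = 0 := by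
  have e : ∀ z, imHessian j k φ z =
      (∂_{(Pi.single k Complex.I : Fin m → ℂ)} (∂_{(Pi.single j 1 : Fin m → ℂ)} φ)) z -
      (∂_{(Pi.single k 1 : Fin m → ℂ)} (∂_{(Pi.single j Complex.I : Fin m → ℂ)} φ)) z :=
    fun z => rfl
  simp only [e, mul_sub]
  rw [integral_sub (integrable_re_comp_linear_mul L hK w _) (integrable_re_comp_linear_mul L hK w _),
    integral_re_comp_linear_mul L hK, integral_re_comp_linear_mul L hK, map_single_I, map_single_I,
    mul_assoc, mul_left_comm Complex.I, sub_self]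

theorem integral_re_sq_mul {E' : Opens (Fin m → ℂ)} (a b : Fin m → ℂ) (φ : 𝓓(E', ℝ)) :
    ∫ z, (L z).re ^ 2 * (∂_{a} (∂_{b} φ)) z = 2 * ((L a).re * (L b).re) * ∫ z, φ z := by
  have h0 : ∀ z v, HasLineDerivAt ℝ (fun z => (L z).re) (L v).re z v := fun z v => by
    simpa using hasLineDerivAt_re_comp_linear L differentiable_id 0 z v
  rw [integral_mul_lineDerivOp_lineDerivOp (q₁ := fun z => 2 * (L a).re * (L z).re)
    (q₂ := fun _ => 2 * (L a).re * (L b).re) (by fun_prop) (by fun_prop) (by fun_prop)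
    (fun z => ?_) (fun z => (h0 z b).const_mul _) φ, integral_const_mul, mul_assoc 2]
  have := HasDerivAt.pow (h0 z a) 2
  simp only [HasLineDerivAt]
  convert! this using 1
  simp
  ring

theorem integral_re_sq_mul_imHessian (j k : Fin m) (φ : 𝓓(tube Ω, ℝ)) :
    ∫ z, (L z).re ^ 2 * imHessian j k φ z =
      2 * ((L (Pi.single j 1)).im * (L (Pi.single k 1)).re -
        (L (Pi.single j 1)).re * (L (Pi.single k 1)).im) * ∫ z, φ z := by
  have e : ∀ z, imHessian j k φ z =
      (∂_{(Pi.single k Complex.I : Fin m → ℂ)} (∂_{(Pi.single j 1 : Fin m → ℂ)} φ)) z -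
      (∂_{(Pi.single k 1 : Fin m → ℂ)} (∂_{(Pi.single j Complex.I : Fin m → ℂ)} φ)) z :=
    fun z => rfl
  have hc : LocallyIntegrable fun z => (L z).re ^ 2 :=
    Continuous.locallyIntegrable (by fun_prop)
  simp only [e, mul_sub]
  rw [integral_sub (integrable_mul_testFunction hc _) (integrable_mul_testFunction hc _),
    integral_re_sq_mul, integral_re_sq_mul, map_single_I, map_single_I]
  simp only [Complex.I_mul_re]
  ring

/-- A shift by `1` or `i` adds `Re h(L z + w)` to the logarithm for almost every `z`, and `ψ`
annihilates such functions by hypothesis. -/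
theorem isLatticePeriodic_pullbackPairing {g : ℂ → ℂ} (hg : HasSimpleLatticeZeros g) (hL : L ≠ 0)
    (ψ : 𝓓(tube Ω, ℝ))
    (hψ : ∀ K : ℂ → ℂ, Differentiable ℂ K → ∀ w, ∫ z, (K (L z + w)).re * ψ z = 0) :
    IsLatticePeriodic (pullbackPairing (fun s => Real.log ‖g s‖) L ψ) := by
  have key : ∀ (h : ℂ → ℂ) (p : ℂ), Differentiable ℂ h →
      (∀ w, g (w + p) = Complex.exp (h w) * g w) → ∀ w,
      pullbackPairing (fun s => Real.log ‖g s‖) L ψ (w + p) =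
        pullbackPairing (fun s => Real.log ‖g s‖) L ψ w := by
    intro h p hd he w
    have h1 : pullbackPairing (fun s => Real.log ‖g s‖) L ψ (w + p) =
        ∫ z, (Real.log ‖g (L z + w)‖ * ψ z + (h (L z + w)).re * ψ z) := by
      refine integral_congr_ae ?_
      filter_upwards [ae_comp_linear hg.ae_ne_zero hL w] with z hz
      rw [← log_norm_exp_mul he hz, ← add_assoc]
      ring
    rw [h1, integral_add (integrable_pullback_mul hg.locallyIntegrable hL ψ.continuous
      ψ.hasCompactSupport w) (integrable_re_comp_linear_mul L hd w ψ), hψ h hd, add_zero]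
    rfl
  obtain ⟨h₁, hd₁, he₁⟩ := hg.add_period (p := 1) ⟨1, 0, by simp⟩
  obtain ⟨h₂, hd₂, he₂⟩ := hg.add_period (p := Complex.I) ⟨0, 1, by simp⟩
  exact ⟨key h₁ 1 hd₁ he₁, key h₂ Complex.I hd₂ he₂⟩

theorem measurable_log_norm {g : ℂ → ℂ} (hg : Continuous g) :
    Measurable fun s => Real.log ‖g s‖ :=
  Real.measurable_log.comp (measurable_norm.comp hg.measurable)

theorem cellIntegral_pullbackPairing_imHessian {g : ℂ → ℂ} (hg : HasSimpleLatticeZeros g)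
    (hL : L ≠ 0) (j k : Fin m) (φ : 𝓓(tube Ω, ℝ)) :
    cellIntegral (pullbackPairing (fun s => Real.log ‖g s‖) L (imHessian j k φ)) 0 =
      2 * Real.pi * ((L (Pi.single j 1)).im * (L (Pi.single k 1)).re -
        (L (Pi.single j 1)).re * (L (Pi.single k 1)).im) * ∫ z, φ z := by
  obtain ⟨K, hK, hM⟩ := hg.cellIntegral_log_norm
  have hc : LocallyIntegrable fun z => (L z).re ^ 2 :=
    Continuous.locallyIntegrable (by fun_prop)
  rw [cellIntegral_pullbackPairing hg.locallyIntegrable (measurable_log_norm hg.1.continuous) hL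
    (imHessian j k φ).continuous (imHessian j k φ).hasCompactSupport]
  simp only [hM, add_mul, mul_assoc Real.pi]
  have h0 := integrable_re_comp_linear_mul L hK 0 (imHessian j k φ)
  have h1 := integral_re_mul_imHessian L hK 0 j k φ
  simp only [add_zero] at h0 h1
  rw [integral_add h0 ((integrable_mul_testFunction hc _).const_mul _), h1, zero_add,
    integral_const_mul, integral_re_sq_mul_imHessian]
  ring

/-- The degenerate case. The outer derivatives can be rearranged to act along vectors of the kernel
of `L`, where `V ∘ L` does not vary. -/
theorem integral_mul_imHessian_eq_zero {V : ℂ → ℝ} (hV : LocallyIntegrable V) (hL : L ≠ 0)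
    {j k : Fin m} (h : (L (Pi.single j 1)).im * (L (Pi.single k 1)).re -
        (L (Pi.single j 1)).re * (L (Pi.single k 1)).im = 0) (φ : 𝓓(tube Ω, ℝ)) :
    ∫ z, V (L z) * imHessian j k φ z = 0 := by
  have hq := locallyIntegrable_comp_linear hV hL
  have hz : ∀ (v : Fin m → ℂ) (ψ : 𝓓(tube Ω, ℝ)), L v = 0 →
      ∫ z, V (L z) * (∂_{v} ψ) z = 0 := fun v ψ hv => by
    refine integral_mul_lineDerivOp_eq_zero hq (fun z t => ?_) ψ
    rw [map_add, ← Complex.coe_smul, map_smul, hv, smul_zero, add_zero]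
  have hsub : ∀ ψ₁ ψ₂ : 𝓓(tube Ω, ℝ), ∫ z, V (L z) * (ψ₁ - ψ₂) z =
      (∫ z, V (L z) * ψ₁ z) - ∫ z, V (L z) * ψ₂ z := fun ψ₁ ψ₂ => by
    rw [← integral_sub (integrable_mul_testFunction hq _) (integrable_mul_testFunction hq _)]
    refine integral_congr_ae (ae_of_all _ fun z => ?_)
    exact mul_sub _ _ _
  by_cases hk : L (Pi.single k 1) = 0
  · rw [imHessian, hsub, hz _ _ (by rw [map_single_I, hk, mul_zero]), hz _ _ hk, sub_zero]
  · obtain ⟨ρ, hρ⟩ : ∃ ρ : ℝ, L (Pi.single j 1) = ρ * L (Pi.single k 1) := by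
      refine ⟨(L (Pi.single j 1) / L (Pi.single k 1)).re, ?_⟩
      have him : (L (Pi.single j 1) / L (Pi.single k 1)).im = 0 := by
        rw [Complex.div_im, ← sub_div, h, zero_div]
      have : ((L (Pi.single j 1) / L (Pi.single k 1)).re : ℂ) =
          L (Pi.single j 1) / L (Pi.single k 1) := Complex.ext (by simp) (by simp [him])
      rw [this, div_mul_cancel₀ _ hk]
    have hn : ∀ a : ℂ, L (Pi.single j a + (-ρ) • (Pi.single k a : Fin m → ℂ)) = 0 := by
      intro a
      have hs : ∀ i, L (Pi.single i a) = a * L (Pi.single i 1) := fun i => by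
        rw [← smul_eq_mul, ← map_smul, ← Pi.single_smul, smul_eq_mul, mul_one]
      rw [map_add, ← Complex.coe_smul, map_smul, hs, hs, hρ, smul_eq_mul]
      push_cast
      ring
    -- The added terms are `ρ` times the two orders of the mixed derivative along `e_k` and `i e_k`,
    -- and cancel by symmetry.
    have e : imHessian j k φ =
        ∂_{(Pi.single j 1 : Fin m → ℂ) + (-ρ) • (Pi.single k 1 : Fin m → ℂ)}
          (∂_{(Pi.single k Complex.I : Fin m → ℂ)} φ) -
        ∂_{(Pi.single j Complex.I : Fin m → ℂ) + (-ρ) • (Pi.single k Complex.I : Fin m → ℂ)}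
          (∂_{(Pi.single k 1 : Fin m → ℂ)} φ) := by
      simp only [LineDeriv.lineDerivOp_left_add, LineDeriv.lineDerivOp_left_smul]
      rw [imHessian, lineDerivOp_comm_testFunction φ (Pi.single k Complex.I) (Pi.single j 1),
        lineDerivOp_comm_testFunction φ (Pi.single k 1) (Pi.single j Complex.I),
        lineDerivOp_comm_testFunction φ (Pi.single k 1) (Pi.single k Complex.I)]
      abel
    rw [e, hsub, hz _ _ (hn 1), hz _ _ (hn Complex.I), sub_zero]

/-! ### The linear form of the divisor and its restriction to `ℝᵐ` -/

/-- The linear form `z ↦ ⟨z, l⟩ + i⟨z, u⟩`. -/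
noncomputable def latticeForm (l u : Fin m → ℝ) : (Fin m → ℂ) →L[ℂ] ℂ :=
  ∑ j, (l j + Complex.I * u j : ℂ) • ContinuousLinearMap.proj j

theorem latticeForm_apply (l u : Fin m → ℝ) (z : Fin m → ℂ) :
    latticeForm l u z = pairing z l + Complex.I * pairing z u := by
  simp only [latticeForm, pairing, sum_apply, smul_apply,
    ContinuousLinearMap.proj_apply, smul_eq_mul, Finset.mul_sum, ← Finset.sum_add_distrib]
  exact Finset.sum_congr rfl fun j _ => by ring

theorem latticeForm_single (l u : Fin m → ℝ) (j : Fin m) :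
    latticeForm l u (Pi.single j 1) = l j + Complex.I * u j := by
  simp [latticeForm, Pi.single_apply]

theorem latticeForm_ne_zero {l u : Fin m → ℝ} (h : l ≠ 0 ∨ u ≠ 0) : latticeForm l u ≠ 0 := by
  intro h0
  have hj : ∀ j, (l j + Complex.I * u j : ℂ) = 0 := fun j => by
    rw [← latticeForm_single, h0]; rfl
  rcases h with h | h
  · exact h (funext fun j => by simpa using congrArg Complex.re (hj j))
  · exact h (funext fun j => by simpa using congrArg Complex.im (hj j))

/-- The inclusion `ℝᵐ ⊆ ℂᵐ` as a continuous linear map. -/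
noncomputable def realVecCLM (m : ℕ) : (Fin m → ℝ) →L[ℝ] (Fin m → ℂ) :=
  ContinuousLinearMap.pi fun j => Complex.ofRealCLM.comp (ContinuousLinearMap.proj j)

theorem surjective_restrict_real {j k : Fin m}
    (h : (L (Pi.single j 1)).im * (L (Pi.single k 1)).re -
        (L (Pi.single j 1)).re * (L (Pi.single k 1)).im ≠ 0) :
    Function.Surjective ((L.restrictScalars ℝ).comp (realVecCLM m)) := by
  set c := L (Pi.single j 1)
  set d := L (Pi.single k 1)
  set D := c.im * d.re - c.re * d.im
  intro w
  have hs : ∀ (i : Fin m) (a : ℝ), ((L.restrictScalars ℝ).comp (realVecCLM m)) (Pi.single i a) =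
      a * L (Pi.single i 1) := by
    intro i a
    change L (realVec (Pi.single i a)) = _
    rw [← smul_eq_mul, ← map_smul]
    congr 1
    funext i'
    by_cases hi : i' = i
    · subst hi; simp [realVec]
    · simp [realVec, hi]
  -- Cramer's rule for the real system `a c + b d = w`.
  refine ⟨Pi.single j ((w.im * d.re - w.re * d.im) / D) +
    Pi.single k ((c.im * w.re - c.re * w.im) / D), ?_⟩
  rw [map_add, hs, hs]
  change _ * c + _ * d = w
  apply Complex.ext
  · simp only [Complex.add_re, Complex.re_ofReal_mul]
    field_simp
    ring
  · simp only [Complex.add_im, Complex.im_ofReal_mul]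
    field_simp
    ring

theorem ofFunction_translate {V : ℂ → ℝ} (hV : LocallyIntegrable V) {L : (Fin m → ℂ) →L[ℂ] ℂ}
    (hL : L ≠ 0) (ψ : 𝓓(tube Ω, ℝ)) (t : Fin m → ℝ) :
    ofFunction Ω (fun z => V (L z)) (translate t ψ) =
      pullbackPairing V L ψ (((L.restrictScalars ℝ).comp (realVecCLM m)) t) := by
  rw [ofFunction_apply (locallyIntegrable_comp_linear hV hL)]
  have := integral_pullback_mul_translate V L ψ 0 (realVec t)
  simp only [add_zero] at this
  exact this

end

end TubeDivisor

/-! ### The main theorem -/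

open TubeDivisor in
theorem mainTheorem3 {m : ℕ} (Ω : TopologicalSpace.Opens (Fin m → ℝ))
    (hΩ : IsConnected (Ω : Set (Fin m → ℝ)))
    (g : ℂ → ℂ) (hg : TubeDivisor.HasSimpleLatticeZeros g)
    (l u : Fin m → ℝ) (hlu : l ≠ 0 ∨ u ≠ 0) :
    TubeDivisor.HasMeanMatrix (TubeDivisor.latticeDivisor Ω g l u)
      (Matrix.vecMulVec u l - Matrix.vecMulVec l u) := by
  set L := latticeForm l u with hLdef
  have hL : L ≠ 0 := latticeForm_ne_zero hlu
  set V : ℂ → ℝ := fun s => Real.log ‖g s‖ with hVdef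
  have hV : LocallyIntegrable V := hg.locallyIntegrable
  set ℓ := (L.restrictScalars ℝ).comp (realVecCLM m) with hℓ
  have hdiv : ∀ j k (φ : 𝓓(tube Ω, ℝ)) (t : Fin m → ℝ),
      latticeDivisor Ω g l u j k (translate t φ) = (1 / (2 * Real.pi) : ℂ) *
        ((pullbackPairing V L (reHessian j k φ) (ℓ t) : ℝ) +
          Complex.I * (pullbackPairing V L (imHessian j k φ) (ℓ t) : ℝ)) := by
    intro j k φ t
    rw [latticeDivisor, divisorCurrent_apply, reHessian_translate, imHessian_translate,
      ← ofFunction_translate hV hL, ← ofFunction_translate hV hL]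
    simp only [hVdef, hLdef, latticeForm_apply]
  have hperR : ∀ j k (φ : 𝓓(tube Ω, ℝ)), IsLatticePeriodic (pullbackPairing V L (reHessian j k φ)) :=
    fun j k φ => isLatticePeriodic_pullbackPairing L hg hL _ fun K hK w =>
      integral_re_mul_reHessian L hK w j k φ
  have hperI : ∀ j k (φ : 𝓓(tube Ω, ℝ)), IsLatticePeriodic (pullbackPairing V L (imHessian j k φ)) :=
    fun j k φ => isLatticePeriodic_pullbackPairing L hg hL _ fun K hK w =>
      integral_re_mul_imHessian L hK w j k φ
  have hcont : ∀ ψ : 𝓓(tube Ω, ℝ), Continuous (pullbackPairing V L ψ) := fun ψ =>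
    continuous_pullbackPairing hV hL ψ.continuous ψ.hasCompactSupport
  refine ⟨fun j k φ => ?_, fun j k φ => ?_⟩
  · simp only [hdiv]
    refine IsLatticePeriodic.isAlmostPeriodic (G := fun w => (1 / (2 * Real.pi) : ℂ) *
        ((pullbackPairing V L (reHessian j k φ) w : ℝ) +
          Complex.I * (pullbackPairing V L (imHessian j k φ) w : ℝ))) ⟨fun w => ?_, fun w => ?_⟩ ?_ ℓ
    · simp only [(hperR j k φ).1, (hperI j k φ).1]
    · simp only [(hperR j k φ).2, (hperI j k φ).2]
    · have h1 := hcont (reHessian j k φ)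
      have h2 := hcont (imHessian j k φ)
      fun_prop
  · have him : ∀ t, Distribution.mapCLM Complex.imCLM (latticeDivisor Ω g l u j k) (translate t φ) =
        (1 / (2 * Real.pi)) * pullbackPairing V L (imHessian j k φ) (ℓ t) := by
      intro t
      rw [Distribution.mapCLM_apply, hdiv, Complex.imCLM_apply]
      have : (1 / (2 * Real.pi) : ℂ) = ((1 / (2 * Real.pi) : ℝ) : ℂ) := by push_cast; rfl
      rw [this, Complex.im_ofReal_mul]
      simp
    have hM : ((Matrix.vecMulVec u l - Matrix.vecMulVec l u) j k • ofFunction Ω 1) φ =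
        (u j * l k - l j * u k) * ∫ z, φ z := by
      change (u j * l k - l j * u k) * ofFunction Ω 1 φ = _
      rw [ofFunction_apply (v := 1) (locallyIntegrable_const (1 : ℝ))]
      simp
    have hdet : (L (Pi.single j 1)).im * (L (Pi.single k 1)).re -
        (L (Pi.single j 1)).re * (L (Pi.single k 1)).im = u j * l k - l j * u k := by
      rw [hLdef, latticeForm_single, latticeForm_single]
      simp
    simp only [him, hM]
    -- Surjectivity of `ℓ` is guaranteed only when this entry is nonzero; otherwise the integrand
    -- itself is zero.
    by_cases hD : u j * l k - l j * u k = 0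
    · have h0 : ∀ t, pullbackPairing V L (imHessian j k φ) (ℓ t) = 0 := fun t => by
        rw [← ofFunction_translate hV hL, ← imHessian_translate,
          ofFunction_apply (locallyIntegrable_comp_linear hV hL)]
        exact integral_mul_imHessian_eq_zero L hV hL (hdet.trans hD) _
      simp [h0, hD]
    · have hsurj : Function.Surjective ℓ := surjective_restrict_real L (hdet ▸ hD)
      have := ((hperI j k φ).tendsto_mean (hcont _) ℓ hsurj).const_mul (1 / (2 * Real.pi))
      rw [cellIntegral_pullbackPairing_imHessian L hg hL, hdet] at this
      convert! this using 1
      · funext N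
        rw [integral_const_mul]
        ring
      · congr 1
        have := Real.pi_ne_zero
        field_simp
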